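/- **Setting.** Let $d\ge 1$, $s_{\max}\ge 1$ be integers, $\mathbb T^d=(\mathbb R/\mathbb Z)^d$, and $\|t\|_\infty=\max_i \operatorname{dist}(t_i,\mathbb Z)$ for $t\in\mathbb T^d$. For a symmetric kernel $K:\mathbb T^d\times\mathbb T^d\to\mathbb R$ of class $C^3$, $\partial_{1,i}$ and $\partial_{2,i}$ are the partial derivatives in the $i$-th coordinate of the first and of the second variable, $\nabla_1$ is the gradient in the first variable and $\nabla_2^2$ the Hessian in the second. Vectors carry the Euclidean norm, matrices the spectral norm, and $\|\nabla_1\nabla_2^2K\|$ is the operator norm of $u\mapsto\sum_l u_l\,\partial_{1,l}\nabla_2^2K$ from the Euclidean to the spectral norm. **Acceptable kernels.** $K$ is *acceptable* for $s_{\max}$, constants $\varepsilon_{\rm near},\Delta,\varepsilon_\eta,\lambda_\eta>0$ and the norm $\|\cdot\|_\infty$ if there are real constants $a_1,a_2,b_2,b_3,\lambda_1,c_0,c_1,e_0,\dots,e_3,h_0,h_1,h_2$ and $v>0$ such that, with $K=K(x,x')$ and for all $x,x'\in\mathbb T^d$ and all indices $i,j$: - if $x=x'$: $K=1$, $|\partial_{1,i}K|\le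 a_1$, $|\partial_{1,i}\partial_{2,j}K|\le a_2$ for $i\ne j$, and $\partial_{1,i}\partial_{2,i}K\ge v$; - if $\|x-x'\|_\infty\le\varepsilon_{\rm near}$: every eigenvalue of $\nabla_2^2K$ lies in $[-b_2,-\lambda_1]$, and $\|\nabla_1\nabla_2^2K\|\le b_3$; - if $\|x-x'\|_\infty\ge\varepsilon_{\rm near}$: $|K|\le c_0$ and $\|\nabla_1K\|\le c_1$; - if $\|x-x'\|_\infty\ge\Delta/2$: $|K|\le \frac{e_0}{s_{\max}}$, $\|\nabla_1K\|\le\frac{e_1}{s_{\max}}$, $\|\nabla_2^2K\|\le\frac{e_2}{s_{\max}}$, $\|\nabla_1\nabla_2^2K\|\le\frac{e_3}{s_{\max}}$; - if $\|x-x'\|_\infty\ge\Delta$: $|K|\le \frac{h_0}{s_{\max}}$, $|\partial_{1,i}K|\le\frac{h_1}{s_{\max}}$, $\sum_{j}|\partial_{1,i}\partial_{2,j}K|\le\frac{h_2}{s_{\max}}$; and such that, with $u=(a_1+h_1)/\sqrt v$, there are $\delta,\delta'<1$ with $$v^{-1}(d a_2+h_2)\le\delta,\qquad h_0+\frac{d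 u^2}{1-\delta}\le\delta',$$ $$\varepsilon_\eta=1-\Big(\frac{c_0+e_0}{1-\delta'}+\frac{u\sqrt d}{\sqrt v(1-\delta)(1-\delta')}(c_1+e_1)\Big)>0,$$ $$\lambda_\eta=\Big(1-\frac{\delta'}{1-\delta'}\Big)\lambda_1-\frac{e_2}{1-\delta'}-\frac{u\sqrt d}{\sqrt v(1-\delta)(1-\delta')}(b_3+e_3)>0,$$ $$\max\Big\{\delta+u,\ \delta'+du\Big(1-\frac{u}{1-\delta}\Big)\Big\}\le\frac12 .$$ **Proposition.** Let $f_c>0$ be an even integer and let $$K(x,x')=\prod_{i=1}^d\kappa(x_i-x_i'),\qquad \kappa(t)=\left(\frac{\sin\left(\left(\frac{f_c}{2}+1\right)\pi t\right)}{\left(\frac{f_c}{2}+1\right)\sin(\pi t)}\right)^4,$$ with $\kappa(t)=1$ for $t\in\mathbb Z$, be the multidimensional Fejér kernel on $\mathbb T^d$. Put $$\varepsilon_{\rm near}=\frac{0.1}{\sqrt d\,f_c},\qquad \Delta=5 f_c^{-1}\sqrt d\,\sqrt[4]{s_{\max}},$$ and assume $\Delta\le\frac{5}{128}$. Then there are $\varepsilon_\eta,\lambda_\eta$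 with $$\varepsilon_\eta\ge\frac{0.0056}{d},\qquad \lambda_\eta\ge 0.0318\,f_c^2,$$ such that $K$ is acceptable for $s_{\max}$, the constants $\varepsilon_{\rm near},\Delta,\varepsilon_\eta,\lambda_\eta$ and the norm $\|\cdot\|_\infty$. -/

import Mathlib

noncomputable section

/-- The torus `𝕋^d = (ℝ/ℤ)^d`.  Its norm is `‖t‖ = max_i dist(t_i, ℤ)`, the infinity norm. -/
abbrev Torus (d : ℕ) : Type := Fin d → UnitAddCircle

/-- The quotient map `ℝ^d → 𝕋^d`. -/
def toTorus {d : ℕ} (x : Fin d → ℝ) : Torus d := fun i => (x i : UnitAddCircle)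

/-! ### Partial derivatives of kernels on the torus -/

/-- `∂_{1,i} K (x, x')`: partial derivative in the `i`-th coordinate of the first variable. -/
def pderivFst {d : ℕ} (i : Fin d) (K : Torus d → Torus d → ℝ) : Torus d → Torus d → ℝ :=
  fun x x' => deriv (fun t : ℝ => K (x + Pi.single i (t : UnitAddCircle)) x') 0

/-- `∂_{2,i} K (x, x')`: partial derivative in the `i`-th coordinate of the second variable. -/
def pderivSnd {d : ℕ} (i : Fin d) (K : Torus d → Torus d → ℝ) : Torus d → Torus d → ℝ :=
  fun x x' => deriv (fun t : ℝ => K x (x' + Pi.single i (t : UnitAddCircle))) 0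

/-- The gradient `∇₁ K (x, x')`, a vector of Euclidean space. -/
def gradFst {d : ℕ} (K : Torus d → Torus d → ℝ) (x x' : Torus d) : EuclideanSpace ℝ (Fin d) :=
  WithLp.toLp 2 fun i => pderivFst i K x x'

/-- The Hessian `∇₂² K (x, x')` in the second variable. -/
def hessSnd {d : ℕ} (K : Torus d → Torus d → ℝ) (x x' : Torus d) : Matrix (Fin d) (Fin d) ℝ :=
  Matrix.of fun i j => pderivSnd i (pderivSnd j K) x x'

/-- The third order tensor `∇₁ ∇₂² K (x, x')`, as the family of matrices `∂_{1,l} ∇₂² K (x, x')`. -/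
def gradFstHessSnd {d : ℕ} (K : Torus d → Torus d → ℝ) (x x' : Torus d) :
    Fin d → Matrix (Fin d) (Fin d) ℝ :=
  fun l => Matrix.of fun i j => pderivFst l (pderivSnd i (pderivSnd j K)) x x'

/-- The spectral norm `‖A‖_{2→2}` of a real square matrix. -/
def specNorm {d : ℕ} (A : Matrix (Fin d) (Fin d) ℝ) : ℝ :=
  ‖Matrix.toEuclideanCLM (n := Fin d) (𝕜 := ℝ) A‖

/-- `‖T‖ ≤ b` for a third order tensor `T = (T_l)_l`, in the operator norm of `u ↦ ∑_l u_l T_l`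
from the Euclidean norm to the spectral norm. -/
def TensorNormLE {d : ℕ} (T : Fin d → Matrix (Fin d) (Fin d) ℝ) (b : ℝ) : Prop :=
  ∀ u : EuclideanSpace ℝ (Fin d), specNorm (∑ l, u l • T l) ≤ b * ‖u‖

/-! ### Acceptable kernels -/

/-- The constants that bound a kernel and its derivatives. -/
structure KernelConstants where
  a₁ : ℝ
  a₂ : ℝ
  v : ℝ
  b₂ : ℝ
  b₃ : ℝ
  lam₁ : ℝ
  c₀ : ℝ
  c₁ : ℝ
  e₀ : ℝ
  e₁ : ℝ
  e₂ : ℝ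
  e₃ : ℝ
  h₀ : ℝ
  h₁ : ℝ
  h₂ : ℝ

/-- The bounds on a kernel `K` on the torus at the different ranges of the separation
`sep (x - x')`.  The kernel is symmetric, and regular enough for every derivative that occurs
to exist. -/
structure KernelBounds {d : ℕ} (K : Torus d → Torus d → ℝ) (sep : Torus d → ℝ) (smax : ℕ)
    (εnear Δ : ℝ) (C : KernelConstants) : Prop where
  smooth : ContDiff ℝ 3
    (fun p : (Fin d → ℝ) × (Fin d → ℝ) => K (toTorus p.1) (toTorus p.2))
  symm : ∀ x x', K x x' = K x' x
  -- `x = x'`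
  diag_zero : ∀ x, K x x = 1
  diag_one : ∀ x i, |pderivFst i K x x| ≤ C.a₁
  diag_two : ∀ x i j, i ≠ j → |pderivFst i (pderivSnd j K) x x| ≤ C.a₂
  diag_two_lower : ∀ x i, C.v ≤ pderivFst i (pderivSnd i K) x x
  v_pos : 0 < C.v
  -- `sep (x - x') ≤ εnear`
  near_two : ∀ x x', sep (x - x') ≤ εnear →
    ∀ μ : ℝ, Module.End.HasEigenvalue (Matrix.toLin' (hessSnd K x x')) μ →
      -C.b₂ ≤ μ ∧ μ ≤ -C.lam₁
  near_three : ∀ x x', sep (x - x') ≤ εnear → TensorNormLE (gradFstHessSnd K x x') C.b₃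
  -- `sep (x - x') ≥ εnear`
  far_zero : ∀ x x', εnear ≤ sep (x - x') → |K x x'| ≤ C.c₀
  far_one : ∀ x x', εnear ≤ sep (x - x') → ‖gradFst K x x'‖ ≤ C.c₁
  -- `sep (x - x') ≥ Δ / 2`
  half_zero : ∀ x x', Δ / 2 ≤ sep (x - x') → |K x x'| ≤ C.e₀ / smax
  half_one : ∀ x x', Δ / 2 ≤ sep (x - x') → ‖gradFst K x x'‖ ≤ C.e₁ / smax
  half_two : ∀ x x', Δ / 2 ≤ sep (x - x') → specNorm (hessSnd K x x') ≤ C.e₂ / smax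
  half_three : ∀ x x', Δ / 2 ≤ sep (x - x') →
    TensorNormLE (gradFstHessSnd K x x') (C.e₃ / smax)
  -- `sep (x - x') ≥ Δ`
  sep_zero : ∀ x x', Δ ≤ sep (x - x') → |K x x'| ≤ C.h₀ / smax
  sep_one : ∀ x x', Δ ≤ sep (x - x') → ∀ i, |pderivFst i K x x'| ≤ C.h₁ / smax
  sep_two : ∀ x x', Δ ≤ sep (x - x') →
    ∀ i, ∑ j, |pderivFst i (pderivSnd j K) x x'| ≤ C.h₂ / smax

/-- `u = (a₁ + h₁) / √v`. -/
def KernelConstants.u (C : KernelConstants) : ℝ := (C.a₁ + C.h₁) / √C.v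

/-- `K` is an acceptable kernel for the maximal number of Diracs `smax`, the constants
`εnear, Δ, εη, lamη > 0` and the separation norm `sep`. -/
def AcceptableKernel {d : ℕ} (K : Torus d → Torus d → ℝ) (sep : Torus d → ℝ) (smax : ℕ)
    (εnear Δ εη lamη : ℝ) : Prop :=
  0 < smax ∧ 0 < εnear ∧ 0 < Δ ∧ 0 < εη ∧ 0 < lamη ∧
  ∃ C : KernelConstants, KernelBounds K sep smax εnear Δ C ∧
  ∃ δ δ' : ℝ, δ < 1 ∧ δ' < 1 ∧
    C.v⁻¹ * (d * C.a₂ + C.h₂) ≤ δ ∧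
    C.h₀ + d * C.u ^ 2 / (1 - δ) ≤ δ' ∧
    εη = 1 - ((C.c₀ + C.e₀) / (1 - δ')
        + C.u * √d / (√C.v * (1 - δ) * (1 - δ')) * (C.c₁ + C.e₁)) ∧
    lamη = (1 - δ' / (1 - δ')) * C.lam₁ - C.e₂ / (1 - δ')
        - C.u * √d / (√C.v * (1 - δ) * (1 - δ')) * (C.b₃ + C.e₃) ∧
    max (δ + C.u) (δ' + d * C.u * (1 - C.u / (1 - δ))) ≤ 1 / 2

/-! ### The Fejér kernel -/

/-- The univariate function `κ`; at the integers the quotient is `0/0` and stands for its limit,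
so that `κ = 1` there. -/
def fejer (fc : ℕ) (t : ℝ) : ℝ :=
  if Real.sin (Real.pi * t) = 0 then 1
  else (Real.sin (((fc : ℝ) / 2 + 1) * Real.pi * t) /
    (((fc : ℝ) / 2 + 1) * Real.sin (Real.pi * t))) ^ 4

theorem fejer_periodic {fc : ℕ} (hfc : Even fc) : Function.Periodic (fejer fc) 1 := by
  intro t
  obtain ⟨m, rfl⟩ := hfc
  have h1 : Real.sin (Real.pi * (t + 1)) = -Real.sin (Real.pi * t) := by
    rw [mul_add, mul_one, Real.sin_add_pi]
  have h2 : Real.sin ((((m + m : ℕ) : ℝ) / 2 + 1) * Real.pi * (t + 1)) =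
      (-1) ^ (m + 1) * Real.sin ((((m + m : ℕ) : ℝ) / 2 + 1) * Real.pi * t) := by
    have : (((m + m : ℕ) : ℝ) / 2 + 1) * Real.pi * (t + 1) =
        (((m + m : ℕ) : ℝ) / 2 + 1) * Real.pi * t + ((m + 1 : ℕ) : ℝ) * Real.pi := by
      push_cast; ring
    rw [this, Real.sin_add_nat_mul_pi]
  unfold fejer
  rw [h1, h2]
  simp only [neg_eq_zero]
  split_ifs
  · rfl
  · rw [div_pow, div_pow, mul_neg, mul_pow, ← pow_mul, (Even.mul_left (by decide) _).neg_one_pow,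
      one_mul, Even.neg_pow (by decide)]

/-- `κ` as a function on the circle `ℝ/ℤ`. -/
def fejerCircle {fc : ℕ} (hfc : Even fc) : UnitAddCircle → ℝ := (fejer_periodic hfc).lift

/-- The multidimensional Fejér kernel `K(x, x') = ∏_i κ(x_i - x'_i)` on `𝕋^d`. -/
def fejerKernel (d : ℕ) {fc : ℕ} (hfc : Even fc) : Torus d → Torus d → ℝ :=
  fun x x' => ∏ i, fejerCircle hfc (x i - x' i)

end

/-!
Write `f_c = 2m`.  Then `κ = D ^ 4`, where `D t = sin ((m + 1) π t) / ((m + 1) sin (π t))` is the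
normalised Dirichlet kernel, and `D` is the mean of `cos (ω t)` over the frequencies
`ω = π (m - 2k)`, `0 ≤ k ≤ m` (`fejer_eq_dirichletDeriv_pow`).  The hypothesis on `Δ` forces
`m ≥ 64`, so that `m + 1` and `m` may be exchanged at little cost.  Everything follows from three
kinds of bounds on `κ`.

* Globally, `|κ⁽ⁿ⁾| ≤ a ^ n` with `a = 4πm = 2π f_c`, since the frequencies of `κ` are at most `a`
  (`abs_iteratedDeriv_fejer_le`).
* Away from the integers, with `S = (m + 1) sin (π t)` and `|S| ≥ 3.9`, one has
  `|κ⁽ⁿ⁾| ≤ c_n a ^ n / S ^ 4`: the identity `D S = sin ((m + 1) π t)`, differentiated three times,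
  bounds the derivatives of `D` by multiples of `1 / |S|` (`abs_iteratedDeriv_fejer_le_decay`).
  At distance `Δ` and `Δ / 2`, `S ^ 4` is at least a multiple of `d ^ 2 * smax`.
* Near the origin the Taylor expansions of the cosines, whose squared frequencies have mean
  `dirichletVar m`, give `κ'' ≤ -12 m ^ 2`, `|κ'| ≤ 13.6 m |m t|`
  (`iteratedDeriv_two_fejer_le`, `abs_iteratedDeriv_one_fejer_le`), and also `κ ≤ 1 - 0.0162 / d`
  at distance at least `εnear` (`fejer_le_one_sub`).

A mixed derivative of `K` is a product of derivatives of `κ` in the coordinates of `x - x'`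
(`hasDerivAt_fejerKernelDeriv`), so each entry of the gradient, the Hessian and the third order
tensor is bounded by a power of `a`, with the decay factor when `x` and `x'` are apart.  The norms
are bounded by the largest entry times a power of `√d`; this loss is harmless because the decay
factor contains `1 / d ^ 2`.  Close to the diagonal the Hessian is negative definite by
`quadForm_fejerKernelDeriv_le`.  The constants are collected in `fejerConstants`.  In the bound for
`εη`, the gain `0.0162 / d` of `c₀` pays for `e₀`, for `δ'` and for the gradient term, each of order
`1 / d` at most (`fejerConstants_bounds`).
-/

noncomputable section

/-! ### The normalised Dirichlet kernel and its derivatives -/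

/-- The frequencies `π (m - 2k)`, `0 ≤ k ≤ m`, of the normalised Dirichlet kernel. -/
def dirichletFreq (m k : ℕ) : ℝ := Real.pi * (m - 2 * k)

/-- The `n`-th derivative of the normalised Dirichlet kernel
`sin ((m + 1) π t) / ((m + 1) sin (π t))`, written as the mean of the `n`-th derivatives
of `cos (ω t)` over the frequencies `ω`.
For odd `m` the kernel changes sign under `t ↦ t + 1`, and only its even powers are `1`-periodic. -/
def dirichletDeriv (m n : ℕ) (t : ℝ) : ℝ :=
  (∑ k ∈ Finset.range (m + 1), dirichletFreq m k ^ n *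
    Real.cos (dirichletFreq m k * t + n * (Real.pi / 2))) / (m + 1)

theorem abs_dirichletFreq_le {m k : ℕ} (hk : k ∈ Finset.range (m + 1)) :
    |dirichletFreq m k| ≤ Real.pi * m := by
  have hk' : (k : ℝ) ≤ m := by exact_mod_cast Nat.lt_succ_iff.1 (Finset.mem_range.1 hk)
  have hk0 : (0 : ℝ) ≤ k := k.cast_nonneg
  rw [dirichletFreq, abs_mul, abs_of_pos Real.pi_pos]
  gcongr
  rw [abs_le]; constructor <;> linarith

theorem dirichletFreq_sq_le {m k : ℕ} (hk : k ∈ Finset.range (m + 1)) :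
    dirichletFreq m k ^ 2 ≤ (Real.pi * m) ^ 2 := by
  rw [← sq_abs]; gcongr; exact abs_dirichletFreq_le hk

/-- The mean of the squared frequencies. -/
def dirichletVar (m : ℕ) : ℝ := Real.pi ^ 2 * ((m : ℝ) ^ 2 + 2 * m) / 3

theorem dirichletVar_nonneg (m : ℕ) : 0 ≤ dirichletVar m := by
  unfold dirichletVar; positivity

theorem sum_dirichletFreq_sq (m : ℕ) :
    ∑ k ∈ Finset.range (m + 1), dirichletFreq m k ^ 2 = dirichletVar m * (m + 1) := by
  have h1 : ∀ n : ℕ, ∑ k ∈ Finset.range (n + 1), (k : ℝ) = n * (n + 1) / 2 := by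
    intro n
    induction n with
    | zero => simp
    | succ n ih => rw [Finset.sum_range_succ, ih]; push_cast; ring
  have h2 : ∀ n : ℕ, ∑ k ∈ Finset.range (n + 1), (k : ℝ) ^ 2 = n * (n + 1) * (2 * n + 1) / 6 := by
    intro n
    induction n with
    | zero => simp
    | succ n ih => rw [Finset.sum_range_succ, ih]; push_cast; ring
  have : ∀ k ∈ Finset.range (m + 1), dirichletFreq m k ^ 2 =
      Real.pi ^ 2 * m ^ 2 - 4 * Real.pi ^ 2 * m * k + 4 * Real.pi ^ 2 * (k : ℝ) ^ 2 := by
    intro k _; unfold dirichletFreq; ring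
  rw [Finset.sum_congr rfl this, Finset.sum_add_distrib, Finset.sum_sub_distrib,
    ← Finset.mul_sum (f := fun k : ℕ => (k : ℝ)), ← Finset.mul_sum (f := fun k : ℕ => (k : ℝ) ^ 2),
    h1, h2, Finset.sum_const, Finset.card_range, nsmul_eq_mul, dirichletVar]
  push_cast
  ring

/-- A mean over the frequencies is bounded above termwise. -/
theorem mean_le_of_le {m : ℕ} {f g : ℕ → ℝ} {b : ℝ}
    (h : ∀ k ∈ Finset.range (m + 1), f k ≤ g k)
    (hg : ∑ k ∈ Finset.range (m + 1), g k = b * (m + 1)) :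
    (∑ k ∈ Finset.range (m + 1), f k) / (m + 1) ≤ b := by
  rw [div_le_iff₀ (by positivity), ← hg]
  exact Finset.sum_le_sum h

theorem hasDerivAt_dirichletDeriv (m n : ℕ) (t : ℝ) :
    HasDerivAt (dirichletDeriv m n) (dirichletDeriv m (n + 1) t) t := by
  unfold dirichletDeriv
  refine HasDerivAt.div_const (HasDerivAt.fun_sum fun k _ => ?_) _
  have h : HasDerivAt (fun t => dirichletFreq m k * t + n * (Real.pi / 2))
      (dirichletFreq m k) t := by
    simpa using ((hasDerivAt_id t).const_mul (dirichletFreq m k)).add_const (n * (Real.pi / 2))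
  refine (h.cos.const_mul (dirichletFreq m k ^ n)).congr_deriv ?_
  have : dirichletFreq m k * t + ((n + 1 : ℕ) : ℝ) * (Real.pi / 2) =
      dirichletFreq m k * t + n * (Real.pi / 2) + Real.pi / 2 := by push_cast; ring
  rw [this, Real.cos_add_pi_div_two]
  ring

theorem abs_dirichletDeriv_le (m n : ℕ) (t : ℝ) :
    |dirichletDeriv m n t| ≤ (Real.pi * m) ^ n := by
  unfold dirichletDeriv
  rw [abs_div, abs_of_pos (by positivity : (0 : ℝ) < m + 1)]
  refine (div_le_div_of_nonneg_right (Finset.abs_sum_le_sum_abs _ _) (by positivity)).trans ?_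
  refine mean_le_of_le (g := fun _ => (Real.pi * m) ^ n) (fun k hk => ?_) ?_
  · rw [abs_mul, abs_pow]
    calc _ ≤ |dirichletFreq m k| ^ n * 1 := by gcongr; exact Real.abs_cos_le_one _
      _ ≤ _ := by rw [mul_one]; gcongr; exact abs_dirichletFreq_le hk
  · simp; ring

theorem contDiff_dirichletDeriv (m n : ℕ) (k : ℕ∞) : ContDiff ℝ k (dirichletDeriv m n) := by
  unfold dirichletDeriv
  fun_prop

theorem dirichletDeriv_neg (m : ℕ) (t : ℝ) : dirichletDeriv m 0 (-t) = dirichletDeriv m 0 t := by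
  unfold dirichletDeriv
  simp

/-- The closed form of the Dirichlet kernel, by telescoping. -/
theorem dirichletDeriv_zero_mul_sin (m : ℕ) (t : ℝ) :
    dirichletDeriv m 0 t * ((m + 1) * Real.sin (Real.pi * t)) =
      Real.sin ((m + 1) * Real.pi * t) := by
  have h : ∀ n ≤ m + 1, 2 * Real.sin (Real.pi * t) *
      ∑ k ∈ Finset.range n, Real.cos (dirichletFreq m k * t) =
      Real.sin ((m + 1) * Real.pi * t) - Real.sin ((m + 1 - 2 * n) * Real.pi * t) := by
    intro n hn
    induction n with
    | zero => simp
    | succ n ih =>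
      rw [Finset.sum_range_succ, mul_add, ih (by omega), Real.two_mul_sin_mul_cos, dirichletFreq,
        show Real.pi * t - Real.pi * (m - 2 * n) * t = -((m + 1 - 2 * (n + 1 : ℕ)) * Real.pi * t)
          by push_cast; ring,
        show Real.pi * t + Real.pi * (m - 2 * n) * t = (m + 1 - 2 * n) * Real.pi * t by ring,
        Real.sin_neg]
      ring
  have h1 := h (m + 1) le_rfl
  rw [show ((m : ℝ) + 1 - 2 * (m + 1 : ℕ)) * Real.pi * t = -((m + 1) * Real.pi * t) by
    push_cast; ring, Real.sin_neg] at h1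
  have h0 : (m : ℝ) + 1 ≠ 0 := by positivity
  unfold dirichletDeriv
  simp only [pow_zero, one_mul, Nat.cast_zero, zero_mul, add_zero]
  rw [div_mul_eq_mul_div, div_eq_iff h0]
  linear_combination ((m : ℝ) + 1) / 2 * h1

theorem fejer_eq_dirichletDeriv_pow (m : ℕ) (t : ℝ) :
    fejer (m + m) t = dirichletDeriv m 0 t ^ 4 := by
  have hm : (((m + m : ℕ) : ℝ) / 2 + 1) = m + 1 := by push_cast; ring
  have h0 : (m : ℝ) + 1 ≠ 0 := by positivity
  unfold fejer
  rw [hm]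
  split_ifs with h
  · -- at an integer `j` every summand is `cos (m j π) = ± 1`
    obtain ⟨j, hj⟩ := Real.sin_eq_zero_iff.1 h
    have hcos : ∀ k ∈ Finset.range (m + 1), dirichletFreq m k ^ 0 *
        Real.cos (dirichletFreq m k * t + (0 : ℕ) * (Real.pi / 2)) =
        Real.cos ((m * j : ℤ) * Real.pi) := by
      intro k _
      rw [show dirichletFreq m k * t + (0 : ℕ) * (Real.pi / 2) =
        (m * j : ℤ) * Real.pi - (k * j : ℤ) * (2 * Real.pi) by
          unfold dirichletFreq; push_cast; linear_combination (2 * (k : ℝ) - m) * hj,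
        Real.cos_sub_int_mul_two_pi, pow_zero, one_mul]
    unfold dirichletDeriv
    rw [Finset.sum_congr rfl hcos, Finset.sum_const, Finset.card_range, nsmul_eq_mul]
    push_cast
    rw [mul_div_cancel_left₀ _ h0, show (4 : ℕ) = 2 * 2 by norm_num, pow_mul]
    have := Real.abs_cos_int_mul_pi (m * j)
    push_cast at this
    rw [← sq_abs (Real.cos _), this]; norm_num
  · rw [← dirichletDeriv_zero_mul_sin, mul_div_cancel_right₀ _ (mul_ne_zero h0 h)]

/-! ### The univariate Fejér kernel: formulas and global bounds for its derivatives -/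

theorem fejer_eq (m : ℕ) : fejer (m + m) = fun t => dirichletDeriv m 0 t ^ 4 :=
  funext (fejer_eq_dirichletDeriv_pow m)

theorem contDiff_fejer (m : ℕ) (k : ℕ∞) : ContDiff ℝ k (fejer (m + m)) := by
  rw [fejer_eq]
  exact (contDiff_dirichletDeriv m 0 k).pow 4

theorem fejer_neg (m : ℕ) (t : ℝ) : fejer (m + m) (-t) = fejer (m + m) t := by
  simp only [fejer_eq_dirichletDeriv_pow, dirichletDeriv_neg]

theorem iteratedDeriv_one_fejer (m : ℕ) : iteratedDeriv 1 (fejer (m + m)) = fun t =>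
    4 * dirichletDeriv m 0 t ^ 3 * dirichletDeriv m 1 t := by
  rw [iteratedDeriv_one, fejer_eq]
  funext t
  simpa using ((hasDerivAt_dirichletDeriv m 0 t).fun_pow 4).deriv

theorem iteratedDeriv_two_fejer (m : ℕ) : iteratedDeriv 2 (fejer (m + m)) = fun t =>
    12 * dirichletDeriv m 0 t ^ 2 * dirichletDeriv m 1 t ^ 2 +
      4 * dirichletDeriv m 0 t ^ 3 * dirichletDeriv m 2 t := by
  rw [iteratedDeriv_succ, iteratedDeriv_one_fejer]
  funext t
  have h0 := hasDerivAt_dirichletDeriv m 0 t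
  have h1 := hasDerivAt_dirichletDeriv m 1 t
  rw [(((h0.fun_pow 3).const_mul 4).fun_mul h1).deriv]
  simp only [zero_add, one_add_one_eq_two]
  push_cast
  ring

theorem iteratedDeriv_three_fejer (m : ℕ) : iteratedDeriv 3 (fejer (m + m)) = fun t =>
    24 * dirichletDeriv m 0 t * dirichletDeriv m 1 t ^ 3 +
      36 * dirichletDeriv m 0 t ^ 2 * dirichletDeriv m 1 t * dirichletDeriv m 2 t +
      4 * dirichletDeriv m 0 t ^ 3 * dirichletDeriv m 3 t := by
  rw [iteratedDeriv_succ, iteratedDeriv_two_fejer]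
  funext t
  have h0 := hasDerivAt_dirichletDeriv m 0 t
  have h1 := hasDerivAt_dirichletDeriv m 1 t
  have h2 := hasDerivAt_dirichletDeriv m 2 t
  rw [((((h0.fun_pow 2).const_mul 12).fun_mul (h1.fun_pow 2)).fun_add
    (((h0.fun_pow 3).const_mul 4).fun_mul h2)).deriv]
  simp only [zero_add, one_add_one_eq_two, two_add_one_eq_three]
  push_cast
  ring

/-- The polynomials in the derivatives of the Dirichlet kernel that give the derivatives of its
fourth power are monotone in absolute value. -/
theorem abs_iteratedDeriv_fejer_le_of_abs_le {m : ℕ} {t b₀ b₁ b₂ b₃ : ℝ}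
    (h₀ : |dirichletDeriv m 0 t| ≤ b₀) (h₁ : |dirichletDeriv m 1 t| ≤ b₁)
    (h₂ : |dirichletDeriv m 2 t| ≤ b₂) (h₃ : |dirichletDeriv m 3 t| ≤ b₃) :
    |iteratedDeriv 0 (fejer (m + m)) t| ≤ b₀ ^ 4 ∧
    |iteratedDeriv 1 (fejer (m + m)) t| ≤ 4 * b₀ ^ 3 * b₁ ∧
    |iteratedDeriv 2 (fejer (m + m)) t| ≤ 12 * b₀ ^ 2 * b₁ ^ 2 + 4 * b₀ ^ 3 * b₂ ∧
    |iteratedDeriv 3 (fejer (m + m)) t| ≤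
      24 * b₀ * b₁ ^ 3 + 36 * b₀ ^ 2 * b₁ * b₂ + 4 * b₀ ^ 3 * b₃ := by
  have n₀ := (abs_nonneg _).trans h₀
  have n₁ := (abs_nonneg _).trans h₁
  have n₂ := (abs_nonneg _).trans h₂
  refine ⟨?_, ?_, ?_, ?_⟩
  · rw [iteratedDeriv_zero, fejer_eq_dirichletDeriv_pow, abs_pow]
    gcongr
  · rw [iteratedDeriv_one_fejer]
    simp only [abs_mul, abs_pow, abs_of_pos (four_pos : (0 : ℝ) < 4)]
    gcongr
  · rw [iteratedDeriv_two_fejer]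
    refine (abs_add_le _ _).trans ?_
    simp only [abs_mul, abs_pow, abs_of_pos (four_pos : (0 : ℝ) < 4),
      abs_of_pos (by norm_num : (0 : ℝ) < 12)]
    gcongr
  · rw [iteratedDeriv_three_fejer]
    refine (abs_add_three _ _ _).trans ?_
    simp only [abs_mul, abs_pow, abs_of_pos (four_pos : (0 : ℝ) < 4),
      abs_of_pos (by norm_num : (0 : ℝ) < 24), abs_of_pos (by norm_num : (0 : ℝ) < 36)]
    gcongr

/-- Bernstein's inequality for the Fejér kernel, whose frequencies are at most `4πm`. -/
theorem abs_iteratedDeriv_fejer_le (m : ℕ) {n : ℕ} (hn : n ≤ 3) (t : ℝ) :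
    |iteratedDeriv n (fejer (m + m)) t| ≤ (4 * Real.pi * m) ^ n := by
  obtain ⟨H₀, H₁, H₂, H₃⟩ := abs_iteratedDeriv_fejer_le_of_abs_le (abs_dirichletDeriv_le m 0 t)
    (abs_dirichletDeriv_le m 1 t) (abs_dirichletDeriv_le m 2 t) (abs_dirichletDeriv_le m 3 t)
  interval_cases n
  · exact H₀.trans_eq (by ring)
  · exact H₁.trans_eq (by ring)
  · exact H₂.trans_eq (by ring)
  · exact H₃.trans_eq (by ring)

/-! ### Decay of the univariate kernel away from the integers -/

/-- The relations between the derivatives of the Dirichlet kernel `D` that come from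
differentiating `D S = sin (A t)` three times, where `S = (m + 1) sin (π t)`, `A = (m + 1) π`. -/
theorem dirichletDeriv_mul_sin_eq (m : ℕ) (t : ℝ) :
    dirichletDeriv m 1 t * ((m + 1) * Real.sin (Real.pi * t)) =
      Real.cos (Real.pi * (m + 1) * t) * (Real.pi * (m + 1)) -
      dirichletDeriv m 0 t * (Real.pi * (m + 1) * Real.cos (Real.pi * t)) ∧
    dirichletDeriv m 2 t * ((m + 1) * Real.sin (Real.pi * t)) =
      -Real.sin (Real.pi * (m + 1) * t) * (Real.pi * (m + 1)) ^ 2 +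
      Real.pi ^ 2 * Real.sin (Real.pi * (m + 1) * t) -
      2 * (dirichletDeriv m 1 t * (Real.pi * (m + 1) * Real.cos (Real.pi * t))) ∧
    dirichletDeriv m 3 t * ((m + 1) * Real.sin (Real.pi * t)) =
      -Real.cos (Real.pi * (m + 1) * t) * (Real.pi * (m + 1)) ^ 3 -
      3 * (dirichletDeriv m 2 t * (Real.pi * (m + 1) * Real.cos (Real.pi * t))) +
      3 * (Real.pi ^ 2 * (dirichletDeriv m 1 t * ((m + 1) * Real.sin (Real.pi * t)))) +
      Real.pi ^ 2 * (dirichletDeriv m 0 t * (Real.pi * (m + 1) * Real.cos (Real.pi * t))) := by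
  set A : ℝ := Real.pi * (m + 1) with hA
  have hS : ∀ t : ℝ, HasDerivAt (fun t => ((m : ℝ) + 1) * Real.sin (Real.pi * t))
      (A * Real.cos (Real.pi * t)) t := by
    intro t
    have h : HasDerivAt (fun t => Real.pi * t) Real.pi t := by
      simpa using (hasDerivAt_id t).const_mul Real.pi
    exact (h.sin.const_mul ((m : ℝ) + 1)).congr_deriv (by rw [hA]; ring)
  have hC : ∀ t : ℝ, HasDerivAt (fun t => A * Real.cos (Real.pi * t))
      (-Real.pi ^ 2 * ((m + 1) * Real.sin (Real.pi * t))) t := by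
    intro t
    have h : HasDerivAt (fun t => Real.pi * t) Real.pi t := by
      simpa using (hasDerivAt_id t).const_mul Real.pi
    exact (h.cos.const_mul A).congr_deriv (by rw [hA]; ring)
  have hAt : ∀ t : ℝ, HasDerivAt (fun t => A * t) A t := fun t => by
    simpa using (hasDerivAt_id t).const_mul A
  have hD := hasDerivAt_dirichletDeriv m
  have e0 : ∀ t, dirichletDeriv m 0 t * ((m + 1) * Real.sin (Real.pi * t)) = Real.sin (A * t) := by
    intro t; rw [dirichletDeriv_zero_mul_sin, hA]; ring_nf
  have e1 : ∀ t, dirichletDeriv m 1 t * ((m + 1) * Real.sin (Real.pi * t)) +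
      dirichletDeriv m 0 t * (A * Real.cos (Real.pi * t)) = Real.cos (A * t) * A := fun t =>
    (((hD 0 t).fun_mul (hS t)).congr_of_eventuallyEq
      (.of_forall fun t => (e0 t).symm)).unique (hAt t).sin
  have e2 : ∀ t, dirichletDeriv m 2 t * ((m + 1) * Real.sin (Real.pi * t)) +
      dirichletDeriv m 1 t * (A * Real.cos (Real.pi * t)) +
      (dirichletDeriv m 1 t * (A * Real.cos (Real.pi * t)) +
        dirichletDeriv m 0 t * (-Real.pi ^ 2 * ((m + 1) * Real.sin (Real.pi * t)))) =
      -Real.sin (A * t) * A * A := fun t =>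
    ((((hD 1 t).fun_mul (hS t)).fun_add ((hD 0 t).fun_mul (hC t))).congr_of_eventuallyEq
      (.of_forall fun t => (e1 t).symm)).unique ((hAt t).cos.mul_const A)
  have e3 := fun t =>
    (((((hD 2 t).fun_mul (hS t)).fun_add ((hD 1 t).fun_mul (hC t))).fun_add
      (((hD 1 t).fun_mul (hC t)).fun_add
        ((hD 0 t).fun_mul ((hS t).const_mul (-Real.pi ^ 2))))).congr_of_eventuallyEq
      (.of_forall fun t => (e2 t).symm)).unique (((hAt t).sin.neg.mul_const A).mul_const A)
  replace e0 := e0 t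
  replace e1 := e1 t
  replace e2 := e2 t
  replace e3 := e3 t
  simp only [zero_add, one_add_one_eq_two, two_add_one_eq_three] at e3
  exact ⟨by linear_combination e1, by linear_combination e2 + Real.pi ^ 2 * e0,
    by linear_combination e3⟩

/-- The estimates for the derivatives of the Dirichlet kernel, deduced from the relations
`dirichletDeriv_mul_sin_eq` when `|S| ≥ 3.9`. -/
theorem abs_le_of_dirichlet_relations {A p S c sA cA D0 D1 D2 D3 : ℝ} (hA0 : 0 < A) (hp0 : 0 ≤ p)
    (hpiA : p ≤ 0.0003 * A ^ 2) (ht : 3.9 ≤ |S|) (hc : |c| ≤ 1) (hsA : |sA| ≤ 1) (hcA : |cA| ≤ 1)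
    (e0 : D0 * S = sA) (e1 : D1 * S = cA * A - D0 * (A * c))
    (e2 : D2 * S = -sA * A ^ 2 + p * sA - 2 * (D1 * (A * c)))
    (e3 : D3 * S = -cA * A ^ 3 - 3 * (D2 * (A * c)) + 3 * (p * (D1 * S)) + p * (D0 * (A * c))) :
    |D0| ≤ |S|⁻¹ ∧ |D1| ≤ 1.26 * A * |S|⁻¹ ∧ |D2| ≤ 1.66 * A ^ 2 * |S|⁻¹ ∧
      |D3| ≤ 2.4 * A ^ 3 * |S|⁻¹ := by
  have hSp : 0 < |S| := by linarith
  have hq : |S|⁻¹ ≤ 0.2565 := by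
    rw [inv_le_comm₀ hSp (by norm_num)]; norm_num at ht ⊢; linarith
  have hq0 : 0 < |S|⁻¹ := inv_pos.2 hSp
  -- an identity `x S = y` turns a bound for `y` into one for `x`
  have key : ∀ x y b : ℝ, x * S = y → |y| ≤ b → |x| ≤ b * |S|⁻¹ := by
    intro x y b h hb
    rw [← div_eq_mul_inv, le_div_iff₀ hSp, ← abs_mul, h]; exact hb
  have d0 : |D0| ≤ |S|⁻¹ := by simpa using key D0 sA 1 e0 hsA
  have hD0 : |D0| ≤ 0.2565 := d0.trans hq
  have hcA' : |A * c| ≤ A := by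
    rw [abs_mul, abs_of_pos hA0]; exact mul_le_of_le_one_right hA0.le hc
  have d1 : |D1| ≤ 1.26 * A * |S|⁻¹ := by
    refine key D1 (cA * A - D0 * (A * c)) _ (by linarith) ?_
    calc _ ≤ |cA| * A + |D0| * |A * c| := by
          refine (abs_sub _ _).trans_eq ?_
          rw [abs_mul, abs_mul D0, abs_of_pos hA0]
      _ ≤ 1 * A + 0.2565 * A := by gcongr
      _ ≤ _ := by linarith
  have hD1 : |D1| ≤ 0.3232 * A := d1.trans (by nlinarith)
  have d2 : |D2| ≤ 1.66 * A ^ 2 * |S|⁻¹ := by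
    refine key D2 (-sA * A ^ 2 + p * sA - 2 * (D1 * (A * c))) _ e2 ?_
    calc _ ≤ |sA| * A ^ 2 + p * |sA| + 2 * (|D1| * |A * c|) := by
          refine (abs_sub _ _).trans ((add_le_add_left (abs_add_le _ _) _).trans_eq ?_)
          simp only [abs_mul, abs_neg, abs_pow, abs_of_pos hA0, abs_of_nonneg hp0, Nat.abs_ofNat]
      _ ≤ 1 * A ^ 2 + 0.0003 * A ^ 2 * 1 + 2 * (0.3232 * A * A) := by gcongr
      _ ≤ _ := by nlinarith
  have hD2 : |D2| ≤ 0.4258 * A ^ 2 := d2.trans (by nlinarith [sq_nonneg A, pow_pos hA0 2])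
  refine ⟨d0, d1, d2, ?_⟩
  refine key D3 (-cA * A ^ 3 - 3 * (D2 * (A * c)) + 3 * (p * (D1 * S))
      + p * (D0 * (A * c))) _ e3 ?_
  have hD1S : |D1 * S| ≤ 1.26 * A := by
    rw [abs_mul, ← le_div_iff₀ hSp, div_eq_mul_inv]; exact d1
  calc _ ≤ |cA| * A ^ 3 + 3 * (|D2| * |A * c|) + 3 * (p * |D1 * S|) +
        p * (|D0| * |A * c|) := by
        refine (abs_add_le _ _).trans (add_le_add ((abs_add_le _ _).trans
          (add_le_add ((abs_sub _ _).trans_eq ?_) (le_of_eq ?_))) (le_of_eq ?_)) <;>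
        simp only [abs_mul, abs_neg, abs_pow, abs_of_pos hA0, abs_of_nonneg hp0, Nat.abs_ofNat]
    _ ≤ 1 * A ^ 3 + 3 * (0.4258 * A ^ 2 * A) + 3 * (0.0003 * A ^ 2 * (1.26 * A)) +
        0.0003 * A ^ 2 * (0.2565 * A) := by gcongr
    _ ≤ _ := by nlinarith [pow_pos hA0 3]

theorem abs_dirichletDeriv_mul_le {m : ℕ} (hm : 64 ≤ m) {t : ℝ}
    (ht : 3.9 ≤ (m + 1) * |Real.sin (Real.pi * t)|) :
    |dirichletDeriv m 0 t| ≤ ((m + 1) * |Real.sin (Real.pi * t)|)⁻¹ ∧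
    |dirichletDeriv m 1 t| ≤
      1.26 * (Real.pi * (m + 1)) * ((m + 1) * |Real.sin (Real.pi * t)|)⁻¹ ∧
    |dirichletDeriv m 2 t| ≤
      1.66 * (Real.pi * (m + 1)) ^ 2 * ((m + 1) * |Real.sin (Real.pi * t)|)⁻¹ ∧
    |dirichletDeriv m 3 t| ≤
      2.4 * (Real.pi * (m + 1)) ^ 3 * ((m + 1) * |Real.sin (Real.pi * t)|)⁻¹ := by
  have hm' : (64 : ℝ) ≤ m := by exact_mod_cast hm
  have hM : (0 : ℝ) < m + 1 := by positivity
  have hpi := Real.pi_pos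
  set A : ℝ := Real.pi * (m + 1) with hA
  have hA0 : 0 < A := by positivity
  obtain ⟨e1, e2, e3⟩ := dirichletDeriv_mul_sin_eq m t
  have e0 : dirichletDeriv m 0 t * ((m + 1) * Real.sin (Real.pi * t)) = Real.sin (A * t) := by
    rw [dirichletDeriv_zero_mul_sin, hA]; ring_nf
  rw [← hA] at e1 e2 e3
  have hSabs : (m + 1) * |Real.sin (Real.pi * t)| = |((m : ℝ) + 1) * Real.sin (Real.pi * t)| := by
    rw [abs_mul, abs_of_pos hM]
  rw [hSabs] at ht ⊢
  have hpiA : Real.pi ^ 2 ≤ 0.0003 * A ^ 2 := by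
    rw [hA, mul_pow]
    have : (65 : ℝ) ^ 2 ≤ (m + 1) ^ 2 := by gcongr; linarith
    nlinarith [sq_nonneg Real.pi, mul_le_mul_of_nonneg_left this (sq_nonneg Real.pi)]
  exact abs_le_of_dirichlet_relations hA0 (sq_nonneg _) hpiA ht (Real.abs_cos_le_one _)
    (Real.abs_sin_le_one _) (Real.abs_cos_le_one _) e0 e1 e2 e3

/-- Ratio between the decay bound for the `n`-th derivative and Bernstein's bound. -/
def decayConst : ℕ → ℝ
  | 0 => 1
  | 1 => 1.3
  | 2 => 1.8
  | _ + 3 => 2.6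

theorem one_le_decayConst (n : ℕ) : 1 ≤ decayConst n := by
  match n with
  | 0 | 1 | 2 | _ + 3 => norm_num [decayConst]

theorem decayConst_mono {a b : ℕ} (h : a ≤ b) : decayConst a ≤ decayConst b := by
  refine monotone_nat_of_le_succ (fun n => ?_) h
  match n with
  | 0 | 1 | 2 | _ + 3 => norm_num [decayConst]

theorem abs_iteratedDeriv_fejer_le_decay {m : ℕ} (hm : 64 ≤ m) {n : ℕ} (hn : n ≤ 3) {t : ℝ}
    (ht : 3.9 ≤ (m + 1) * |Real.sin (Real.pi * t)|) :
    |iteratedDeriv n (fejer (m + m)) t| ≤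
      decayConst n * (4 * Real.pi * m) ^ n * ((m + 1) * |Real.sin (Real.pi * t)|)⁻¹ ^ 4 := by
  have hm' : (64 : ℝ) ≤ m := by exact_mod_cast hm
  have hpi := Real.pi_pos
  obtain ⟨h₀, h₁, h₂, h₃⟩ := abs_dirichletDeriv_mul_le hm ht
  obtain ⟨H₀, H₁, H₂, H₃⟩ := abs_iteratedDeriv_fejer_le_of_abs_le h₀ h₁ h₂ h₃
  set q := ((m + 1) * |Real.sin (Real.pi * t)|)⁻¹
  have hq : 0 ≤ q ^ 4 := by positivity
  have hA : Real.pi * (m + 1) ≤ 0.254 * (4 * Real.pi * m) := by nlinarith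
  have hA0 : 0 ≤ Real.pi * ((m : ℝ) + 1) := by positivity
  interval_cases n
  · exact H₀.trans_eq (by simp [decayConst])
  · refine H₁.trans ?_
    calc _ = 5.04 * (Real.pi * (m + 1)) * q ^ 4 := by ring
      _ ≤ 5.04 * (0.254 * (4 * Real.pi * m)) * q ^ 4 := by gcongr
      _ ≤ _ := by
        refine mul_le_mul_of_nonneg_right ?_ hq
        norm_num [decayConst]; nlinarith [mul_pos hpi (by linarith : (0 : ℝ) < m)]
  · refine H₂.trans ?_
    calc _ = 25.6912 * (Real.pi * (m + 1)) ^ 2 * q ^ 4 := by ring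
      _ ≤ 25.6912 * (0.254 * (4 * Real.pi * m)) ^ 2 * q ^ 4 := by gcongr
      _ ≤ _ := by
        refine mul_le_mul_of_nonneg_right ?_ hq
        rw [mul_pow, ← mul_assoc]
        refine mul_le_mul_of_nonneg_right ?_ (by positivity)
        norm_num [decayConst]
  · refine H₃.trans ?_
    calc _ = (24 * 1.26 ^ 3 + 36 * 1.26 * 1.66 + 4 * 2.4) * (Real.pi * (m + 1)) ^ 3 * q ^ 4 := by
          ring
      _ ≤ (24 * 1.26 ^ 3 + 36 * 1.26 * 1.66 + 4 * 2.4) *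
          (0.254 * (4 * Real.pi * m)) ^ 3 * q ^ 4 := by gcongr
      _ ≤ _ := by
        refine mul_le_mul_of_nonneg_right ?_ hq
        rw [mul_pow, ← mul_assoc]
        refine mul_le_mul_of_nonneg_right ?_ (by positivity)
        norm_num [decayConst]

/-! ### The univariate kernel near the origin -/

/-- A mean over the frequencies is bounded below termwise. -/
theorem le_mean_of_le {m : ℕ} {f g : ℕ → ℝ} {b : ℝ}
    (h : ∀ k ∈ Finset.range (m + 1), g k ≤ f k)
    (hg : ∑ k ∈ Finset.range (m + 1), g k = b * (m + 1)) :
    b ≤ (∑ k ∈ Finset.range (m + 1), f k) / (m + 1) := by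
  rw [le_div_iff₀ (by positivity), ← hg]
  exact Finset.sum_le_sum h

theorem cos_le_one_sub_sq_add_pow_four {x : ℝ} (hx : x ^ 2 ≤ 4) :
    Real.cos x ≤ 1 - x ^ 2 / 2 + x ^ 4 / 24 := by
  wlog h : 0 ≤ x generalizing x
  · have := @this (-x) (by simpa using hx) (by linarith)
    simpa [Even.neg_pow (by decide : Even 4)] using this
  have h1 := Real.sin_ge_sub_cube (x := x / 2) (by linarith)
  have h0 : 0 ≤ x / 2 - (x / 2) ^ 3 / 6 := by nlinarith [mul_nonneg h (sub_nonneg.2 hx)]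
  have h2 : (x / 2 - (x / 2) ^ 3 / 6) ^ 2 ≤ Real.sin (x / 2) ^ 2 := by gcongr
  have h3 : Real.cos x = 1 - 2 * Real.sin (x / 2) ^ 2 := by
    have h4 := Real.cos_two_mul (x / 2)
    rw [Real.cos_sq', mul_div_cancel₀ x two_ne_zero] at h4
    linarith
  nlinarith [sq_nonneg ((x / 2) ^ 3)]

theorem one_sub_le_dirichletDeriv (m : ℕ) (t : ℝ) :
    1 - dirichletVar m * t ^ 2 / 2 ≤ dirichletDeriv m 0 t := by
  unfold dirichletDeriv
  refine le_mean_of_le (g := fun k => 1 - dirichletFreq m k ^ 2 * (t ^ 2 / 2)) (fun k _ => ?_) ?_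
  · have := Real.one_sub_sq_div_two_le_cos (x := dirichletFreq m k * t)
    simp only [pow_zero, one_mul, Nat.cast_zero, zero_mul, add_zero]
    linarith
  · rw [Finset.sum_sub_distrib, ← Finset.sum_mul, sum_dirichletFreq_sq]
    simp; ring

theorem dirichletDeriv_le {m : ℕ} {t : ℝ} (ht : (Real.pi * m * t) ^ 2 ≤ 4) :
    dirichletDeriv m 0 t ≤
      1 - dirichletVar m * t ^ 2 / 2 * (1 - (Real.pi * m * t) ^ 2 / 12) := by
  unfold dirichletDeriv
  refine mean_le_of_le (g := fun k => 1 - dirichletFreq m k ^ 2 *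
    (t ^ 2 / 2 * (1 - (Real.pi * m * t) ^ 2 / 12))) (fun k hk => ?_) ?_
  · have hω : (dirichletFreq m k * t) ^ 2 ≤ (Real.pi * m * t) ^ 2 := by
      rw [mul_pow, mul_pow _ t]
      exact mul_le_mul_of_nonneg_right (dirichletFreq_sq_le hk) (sq_nonneg _)
    have := cos_le_one_sub_sq_add_pow_four (hω.trans ht)
    simp only [pow_zero, one_mul, Nat.cast_zero, zero_mul, add_zero]
    nlinarith [mul_le_mul_of_nonneg_left hω (sq_nonneg (dirichletFreq m k * t))]
  · rw [Finset.sum_sub_distrib, ← Finset.sum_mul, sum_dirichletFreq_sq]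
    simp; ring

theorem abs_dirichletDeriv_one_le (m : ℕ) (t : ℝ) :
    |dirichletDeriv m 1 t| ≤ dirichletVar m * |t| := by
  unfold dirichletDeriv
  rw [abs_div, abs_of_pos (by positivity : (0 : ℝ) < m + 1)]
  refine (div_le_div_of_nonneg_right (Finset.abs_sum_le_sum_abs _ _) (by positivity)).trans ?_
  refine mean_le_of_le (g := fun k => dirichletFreq m k ^ 2 * |t|) (fun k _ => ?_) ?_
  · simp only [pow_one, Nat.cast_one, one_mul, Real.cos_add_pi_div_two, abs_mul, abs_neg]
    calc _ ≤ |dirichletFreq m k| * |dirichletFreq m k * t| := by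
          exact mul_le_mul_of_nonneg_left Real.abs_sin_le_abs (abs_nonneg _)
      _ = _ := by rw [abs_mul, ← sq_abs (dirichletFreq m k)]; ring
  · rw [← Finset.sum_mul, sum_dirichletFreq_sq]; ring

theorem dirichletDeriv_two_le (m : ℕ) (t : ℝ) :
    dirichletDeriv m 2 t ≤ -(dirichletVar m * (1 - (Real.pi * m * t) ^ 2 / 2)) := by
  unfold dirichletDeriv
  refine mean_le_of_le (g := fun k => -(dirichletFreq m k ^ 2 * (1 - (Real.pi * m * t) ^ 2 / 2)))
    (fun k hk => ?_) ?_
  · have hω : (dirichletFreq m k * t) ^ 2 ≤ (Real.pi * m * t) ^ 2 := by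
      rw [mul_pow, mul_pow _ t]
      exact mul_le_mul_of_nonneg_right (dirichletFreq_sq_le hk) (sq_nonneg _)
    have := Real.one_sub_sq_div_two_le_cos (x := dirichletFreq m k * t)
    rw [show dirichletFreq m k * t + (2 : ℕ) * (Real.pi / 2) = dirichletFreq m k * t + Real.pi by
      push_cast; ring, Real.cos_add_pi, mul_neg]
    refine neg_le_neg (mul_le_mul_of_nonneg_left ?_ (sq_nonneg _))
    linarith
  · rw [Finset.sum_neg_distrib, ← Finset.sum_mul, sum_dirichletFreq_sq]; ring

theorem pi_sq_bounds : 9.869 ≤ Real.pi ^ 2 ∧ Real.pi ^ 2 ≤ 9.87 := by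
  have h1 := Real.pi_gt_d4
  have h2 := Real.pi_lt_d4
  constructor <;> norm_num at h1 h2 ⊢ <;> nlinarith

theorem dirichletVar_lower (m : ℕ) : 3.289 * (m : ℝ) ^ 2 ≤ dirichletVar m := by
  unfold dirichletVar
  have := pi_sq_bounds.1
  norm_num at this ⊢
  nlinarith [mul_le_mul_of_nonneg_right this (by positivity : (0 : ℝ) ≤ m ^ 2 + 2 * m),
    m.cast_nonneg (α := ℝ), sq_nonneg (m : ℝ)]

theorem dirichletVar_upper {m : ℕ} (hm : 64 ≤ m) : dirichletVar m ≤ 3.4 * (m : ℝ) ^ 2 := by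
  unfold dirichletVar
  have hm' : (64 : ℝ) ≤ m := by exact_mod_cast hm
  have := pi_sq_bounds.2
  norm_num at this ⊢
  nlinarith [mul_le_mul_of_nonneg_right this (by positivity : (0 : ℝ) ≤ m ^ 2 + 2 * m)]

theorem abs_iteratedDeriv_one_fejer_le {m : ℕ} (hm : 64 ≤ m) (t : ℝ) :
    |iteratedDeriv 1 (fejer (m + m)) t| ≤ 13.6 * m * |m * t| := by
  rw [iteratedDeriv_one_fejer]
  simp only [abs_mul, abs_pow, abs_of_pos (four_pos : (0 : ℝ) < 4), Nat.abs_cast]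
  have h0 : |dirichletDeriv m 0 t| ≤ 1 := by simpa using abs_dirichletDeriv_le m 0 t
  calc _ ≤ 4 * 1 ^ 3 * (3.4 * (m : ℝ) ^ 2 * |t|) := by
        gcongr
        exact (abs_dirichletDeriv_one_le m t).trans (by gcongr; exact dirichletVar_upper hm)
    _ = _ := by ring

theorem one_sub_le_fejer {m : ℕ} (hm : 64 ≤ m) {t : ℝ} (ht : (m * t) ^ 2 ≤ 0.0025) :
    1 - 6.8 * (m * t) ^ 2 ≤ fejer (m + m) t := by
  rw [fejer_eq_dirichletDeriv_pow]
  have h := one_sub_le_dirichletDeriv m t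
  have hv : dirichletVar m * t ^ 2 ≤ 3.4 * (m * t) ^ 2 := by
    calc _ ≤ 3.4 * (m : ℝ) ^ 2 * t ^ 2 := by gcongr; exact dirichletVar_upper hm
      _ = _ := by ring
  set y := (m * t) ^ 2
  calc _ ≤ (1 - 1.7 * y) ^ 4 := by
        have := one_add_mul_le_pow (a := -(1.7 * y)) (by norm_num at ht ⊢; linarith) 4
        push_cast at this
        rw [← sub_eq_add_neg] at this
        refine le_trans (by linarith) this
    _ ≤ _ := pow_le_pow_left₀ (by norm_num at ht ⊢; linarith) (by linarith) 4

theorem iteratedDeriv_two_fejer_le {m : ℕ} (hm : 64 ≤ m) {t : ℝ} (ht : (m * t) ^ 2 ≤ 0.0025) :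
    iteratedDeriv 2 (fejer (m + m)) t ≤ -12 * m ^ 2 := by
  rw [iteratedDeriv_two_fejer]
  have hm2 : (0 : ℝ) ≤ m ^ 2 := sq_nonneg _
  have hv : dirichletVar m * t ^ 2 ≤ 3.4 * (m * t) ^ 2 := by
    calc _ ≤ 3.4 * (m : ℝ) ^ 2 * t ^ 2 := by gcongr; exact dirichletVar_upper hm
      _ = _ := by ring
  have hD : 0.995 ≤ dirichletDeriv m 0 t := by
    have h := one_sub_le_dirichletDeriv m t
    norm_num at ht ⊢; linarith
  have hD1 : dirichletDeriv m 0 t ≤ 1 :=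
    (le_abs_self _).trans (by simpa using abs_dirichletDeriv_le m 0 t)
  have hD3 : 0.98 ≤ dirichletDeriv m 0 t ^ 3 := by
    refine le_trans ?_ (pow_le_pow_left₀ (by norm_num) hD 3)
    norm_num
  have h1 : dirichletDeriv m 1 t ^ 2 ≤ 0.03 * m ^ 2 := by
    rw [← sq_abs]
    calc _ ≤ (3.4 * (m : ℝ) ^ 2 * |t|) ^ 2 := by
          gcongr
          exact (abs_dirichletDeriv_one_le m t).trans (by gcongr; exact dirichletVar_upper hm)
      _ = 11.56 * m ^ 2 * (m * t) ^ 2 := by rw [mul_pow, sq_abs]; ring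
      _ ≤ 11.56 * m ^ 2 * 0.0025 := by gcongr
      _ ≤ _ := by linarith
  have h2 : dirichletDeriv m 2 t ≤ -(3.2 * m ^ 2) := by
    refine (dirichletDeriv_two_le m t).trans (neg_le_neg ?_)
    have hW : (Real.pi * m * t) ^ 2 / 2 ≤ 0.0125 := by
      rw [mul_assoc, mul_pow]
      have := mul_le_mul pi_sq_bounds.2 ht (sq_nonneg _) (by norm_num)
      norm_num at this ⊢; linarith
    calc _ ≤ 3.289 * (m : ℝ) ^ 2 * (1 - 0.0125) := by linarith
      _ ≤ _ := by
        refine mul_le_mul (dirichletVar_lower m) (by linarith) (by norm_num) (dirichletVar_nonneg m)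
  have h3 : dirichletDeriv m 0 t ^ 2 ≤ 1 := pow_le_one₀ (by linarith) hD1
  have h4 := mul_le_mul h3 h1 (sq_nonneg _) zero_le_one
  have h5 := mul_le_mul hD3 (le_neg.1 h2) (by positivity) (by linarith)
  norm_num at h4 h5 ⊢
  linarith

/-! ### The univariate kernel away from the origin -/

theorem le_mul_abs_sin {m : ℕ} {ρ t : ℝ} (hρ0 : 0 ≤ ρ) (hρ : ρ ≤ 5 / 128) (hρt : ρ ≤ |t|)
    (ht : |t| ≤ 1 / 2) : 0.997 * Real.pi * m * ρ ≤ (m + 1) * |Real.sin (Real.pi * t)| := by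
  have hpi := Real.pi_pos
  have h1 : |Real.sin (Real.pi * t)| = Real.sin (Real.pi * |t|) := by
    rw [Real.abs_sin_eq_sin_abs_of_abs_le_pi, abs_mul, abs_of_pos hpi]
    rw [abs_mul, abs_of_pos hpi]; nlinarith
  have h2 : Real.sin (Real.pi * ρ) ≤ Real.sin (Real.pi * |t|) :=
    Real.sin_le_sin_of_le_of_le_pi_div_two (by nlinarith) (by nlinarith) (by gcongr)
  have h3 := Real.sin_ge_sub_cube (x := Real.pi * ρ) (by positivity)
  have h4 : (Real.pi * ρ) ^ 2 ≤ 0.016 := by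
    rw [mul_pow]
    have : ρ ^ 2 ≤ (5 / 128) ^ 2 := by gcongr
    have := mul_le_mul pi_sq_bounds.2 this (sq_nonneg _) (by norm_num)
    norm_num at this ⊢; linarith
  have h5 : 0.997 * (Real.pi * ρ) ≤ |Real.sin (Real.pi * t)| := by
    have h6 : 0 ≤ Real.pi * ρ := by positivity
    have := mul_le_mul_of_nonneg_left h4 h6
    rw [h1]
    norm_num at this ⊢
    nlinarith
  calc _ = m * (0.997 * (Real.pi * ρ)) := by ring
    _ ≤ m * |Real.sin (Real.pi * t)| := by gcongr
    _ ≤ _ := by gcongr; linarith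

/-- Away from the origin the kernel is bounded away from `1`.  Up to `m |t| = 0.4` this comes from
the Taylor expansion of the Dirichlet kernel, and beyond from the decay of the kernel. -/
theorem fejer_le_one_sub {m : ℕ} (hm : 64 ≤ m) {r t : ℝ} (hr0 : 0 ≤ r) (hr : r ≤ 1)
    (hrt : 0.0025 * r ≤ (m * t) ^ 2) (ht : |t| ≤ 1 / 2) :
    fejer (m + m) t ≤ 1 - 0.0162 * r := by
  have hm' : (64 : ℝ) ≤ m := by exact_mod_cast hm
  have hm0 : (0 : ℝ) < m := by linarith
  rcases le_total ((m * t) ^ 2) 0.16 with h | h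
  · rw [fejer_eq_dirichletDeriv_pow]
    have hW : (Real.pi * m * t) ^ 2 ≤ 9.87 * (m * t) ^ 2 := by
      rw [mul_assoc, mul_pow]
      exact mul_le_mul_of_nonneg_right pi_sq_bounds.2 (sq_nonneg _)
    have h1 := dirichletDeriv_le (m := m) (t := t) (by norm_num at h hW ⊢; linarith)
    have h2 := one_sub_le_dirichletDeriv m t
    have hvl : 3.289 * (m * t) ^ 2 ≤ dirichletVar m * t ^ 2 := by
      calc _ = 3.289 * (m : ℝ) ^ 2 * t ^ 2 := by ring
        _ ≤ _ := by gcongr; exact dirichletVar_lower m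
    have hvu : dirichletVar m * t ^ 2 ≤ 3.4 * (m * t) ^ 2 := by
      calc _ ≤ 3.4 * (m : ℝ) ^ 2 * t ^ 2 := by gcongr; exact dirichletVar_upper hm
        _ = _ := by ring
    set y := (m * t) ^ 2
    have hz : 0.0041 * r ≤ dirichletVar m * t ^ 2 / 2 * (1 - (Real.pi * m * t) ^ 2 / 12) := by
      calc 0.0041 * r ≤ 1.6445 * (0.0025 * r) * (1 - 0.8225 * (0.0025 * r)) := by
            norm_num; nlinarith
        _ ≤ 1.6445 * y * (1 - 0.8225 * y) := by
            -- `y (1 - c y)` increases as long as `2 c y ≤ 1`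
            norm_num at h hrt ⊢
            nlinarith [mul_nonneg (sub_nonneg.2 hrt)
              (by linarith : 0 ≤ 1 - 329 / 400 * (y + 1 / 400 * r))]
        _ ≤ _ := by
            norm_num at h hW hvl ⊢
            refine mul_le_mul ?_ ?_ ?_ ?_ <;> linarith [sq_nonneg (m * t)]
    calc _ ≤ (1 - 0.0041 * r) ^ 4 :=
          pow_le_pow_left₀ (by norm_num at h ⊢; linarith) (by linarith) 4
      _ ≤ _ := by
        have : (1 - 0.0041 * r) ^ 2 ≤ 1 - 0.00818 * r := by norm_num; nlinarith
        calc _ = ((1 - 0.0041 * r) ^ 2) ^ 2 := by ring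
          _ ≤ (1 - 0.00818 * r) ^ 2 := by gcongr
          _ ≤ _ := by norm_num; nlinarith
  · have h1 : 0.4 / m ≤ |t| := by
      rw [div_le_iff₀ hm0, mul_comm, ← Nat.abs_cast (R := ℝ), ← abs_mul]
      refine le_of_sq_le_sq ?_ (abs_nonneg _)
      rw [sq_abs]; norm_num at h ⊢; exact h
    have h2 := le_mul_abs_sin (m := m) (by positivity) (by
      rw [div_le_iff₀ hm0]; norm_num; linarith) h1 ht
    have h3 : 1.25 ≤ (m + 1) * |Real.sin (Real.pi * t)| := by
      refine le_trans ?_ h2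
      have := Real.pi_gt_d2
      rw [mul_assoc, mul_div_cancel₀ _ hm0.ne']
      norm_num at this ⊢; linarith
    have h4 : |dirichletDeriv m 0 t| ≤ 0.8 := by
      have h5 : |dirichletDeriv m 0 t| * ((m + 1) * |Real.sin (Real.pi * t)|) ≤ 1 := by
        rw [← abs_of_pos (by positivity : (0 : ℝ) < m + 1), ← abs_mul, ← abs_mul,
          dirichletDeriv_zero_mul_sin]
        exact Real.abs_sin_le_one _
      have := mul_le_mul_of_nonneg_left h3 (abs_nonneg (dirichletDeriv m 0 t))
      norm_num at this ⊢; linarith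
    rw [fejer_eq_dirichletDeriv_pow, ← Even.pow_abs (by decide)]
    calc _ ≤ (0.8 : ℝ) ^ 4 := by gcongr
      _ ≤ _ := by norm_num; linarith

/-! ### Derivatives of product kernels on the torus -/

theorem periodic_iteratedDeriv {f : ℝ → ℝ} {c : ℝ} (hf : Function.Periodic f c) (n : ℕ) :
    Function.Periodic (iteratedDeriv n f) c := by
  intro t
  have h := congrFun (iteratedDeriv_comp_add_const n f c) t
  rw [show (fun z => f (z + c)) = f from funext hf] at h
  exact h.symm

/-- The `n`-th derivative of the univariate Fejér kernel as a function on the circle. -/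
def fejerCircleDeriv {fc : ℕ} (hfc : Even fc) (n : ℕ) : UnitAddCircle → ℝ :=
  (periodic_iteratedDeriv (fejer_periodic hfc) n).lift

@[simp] theorem fejerCircleDeriv_coe {fc : ℕ} (hfc : Even fc) (n : ℕ) (t : ℝ) :
    fejerCircleDeriv hfc n (t : UnitAddCircle) = iteratedDeriv n (fejer fc) t := rfl

/-- The derivative `∂^ν K` of the Fejér kernel, as a function of `x - x'`, for a multi-index `ν`. -/
def fejerKernelDeriv {d fc : ℕ} (hfc : Even fc) (ν : Fin d → ℕ) (y : Torus d) : ℝ :=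
  ∏ k, fejerCircleDeriv hfc (ν k) (y k)

theorem fejerKernel_eq {d fc : ℕ} (hfc : Even fc) :
    fejerKernel d hfc = fun x x' => 1 * fejerKernelDeriv hfc 0 (x - x') := by
  funext x x'
  rw [one_mul]
  unfold fejerKernel fejerKernelDeriv fejerCircle fejerCircleDeriv
  simp

theorem hasDerivAt_iteratedDeriv_fejer {fc : ℕ} (hfc : Even fc) (n : ℕ) (t : ℝ) :
    HasDerivAt (iteratedDeriv n (fejer fc)) (iteratedDeriv (n + 1) (fejer fc) t) t := by
  obtain ⟨m, rfl⟩ := hfc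
  rw [iteratedDeriv_succ]
  refine (((contDiff_fejer m (n + 1 : ℕ)).differentiable_iteratedDeriv n ?_) t).hasDerivAt
  exact_mod_cast Nat.lt_succ_self n

theorem hasDerivAt_fejerKernelDeriv {d fc : ℕ} (hfc : Even fc) (ν : Fin d → ℕ) (y : Torus d)
    (i : Fin d) :
    HasDerivAt (fun t : ℝ => fejerKernelDeriv hfc ν (y + Pi.single i (t : UnitAddCircle)))
      (fejerKernelDeriv hfc (ν + Pi.single i 1) y) 0 := by
  obtain ⟨s, hs⟩ := QuotientAddGroup.mk_surjective (y i)
  replace hs : (s : UnitAddCircle) = y i := hs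
  have h1 : (fun t : ℝ => fejerKernelDeriv hfc ν (y + Pi.single i (t : UnitAddCircle))) =
      fun t => iteratedDeriv (ν i) (fejer fc) (s + t) *
        ∏ k ∈ Finset.univ.erase i, fejerCircleDeriv hfc (ν k) (y k) := by
    funext t
    unfold fejerKernelDeriv
    rw [← Finset.mul_prod_erase _ _ (Finset.mem_univ i)]
    congr 1
    · rw [Pi.add_apply, Pi.single_eq_same, ← hs, ← AddCircle.coe_add, fejerCircleDeriv_coe]
    · refine Finset.prod_congr rfl fun k hk => ?_
      rw [Pi.add_apply, Pi.single_eq_of_ne (Finset.ne_of_mem_erase hk), add_zero]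
  have h2 : fejerKernelDeriv hfc (ν + Pi.single i 1) y =
      iteratedDeriv (ν i + 1) (fejer fc) (s + 0) *
        ∏ k ∈ Finset.univ.erase i, fejerCircleDeriv hfc (ν k) (y k) := by
    unfold fejerKernelDeriv
    rw [← Finset.mul_prod_erase _ _ (Finset.mem_univ i)]
    congr 1
    · rw [Pi.add_apply, Pi.single_eq_same, ← hs, fejerCircleDeriv_coe, add_zero]
    · refine Finset.prod_congr rfl fun k hk => ?_
      rw [Pi.add_apply, Pi.single_eq_of_ne (Finset.ne_of_mem_erase hk), add_zero]
  rw [h1, h2]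
  refine HasDerivAt.mul_const ?_ _
  exact (hasDerivAt_iteratedDeriv_fejer hfc (ν i) (s + 0)).comp_const_add s 0

theorem pderivFst_fejerKernelDeriv {d fc : ℕ} (hfc : Even fc) (ν : Fin d → ℕ) (i : Fin d) (c : ℝ) :
    pderivFst i (fun x x' : Torus d => c * fejerKernelDeriv hfc ν (x - x')) =
      fun x x' => c * fejerKernelDeriv hfc (ν + Pi.single i 1) (x - x') := by
  funext x x'
  unfold pderivFst
  simp only [add_sub_right_comm]
  exact ((hasDerivAt_fejerKernelDeriv hfc ν (x - x') i).const_mul c).deriv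

theorem pderivSnd_fejerKernelDeriv {d fc : ℕ} (hfc : Even fc) (ν : Fin d → ℕ) (i : Fin d) (c : ℝ) :
    pderivSnd i (fun x x' : Torus d => c * fejerKernelDeriv hfc ν (x - x')) =
      fun x x' => -c * fejerKernelDeriv hfc (ν + Pi.single i 1) (x - x') := by
  funext x x'
  unfold pderivSnd
  have h1 : ∀ t : ℝ, x - (x' + Pi.single i (t : UnitAddCircle)) =
      x - x' + Pi.single i ((-t : ℝ) : UnitAddCircle) := by
    intro t
    rw [AddCircle.coe_neg, Pi.single_neg]; abel
  simp only [h1]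
  have h2 := hasDerivAt_fejerKernelDeriv hfc ν (x - x') i
  rw [← neg_zero] at h2
  have h3 := (h2.scomp (0 : ℝ) (hasDerivAt_neg (0 : ℝ))).const_mul c
  refine Eq.trans h3.deriv ?_
  simp

section Formulas

variable {d fc : ℕ} (hfc : Even fc) (x x' : Torus d) (i j l : Fin d)

theorem fejerKernel_apply : fejerKernel d hfc x x' = fejerKernelDeriv hfc 0 (x - x') := by
  rw [fejerKernel_eq]
  exact one_mul _

theorem pderivFst_fejerKernel : pderivFst i (fejerKernel d hfc) x x' =
    fejerKernelDeriv hfc (Pi.single i 1) (x - x') := by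
  rw [fejerKernel_eq, pderivFst_fejerKernelDeriv, zero_add]
  exact one_mul _

theorem pderivFst_pderivSnd_fejerKernel : pderivFst i (pderivSnd j (fejerKernel d hfc)) x x' =
    -fejerKernelDeriv hfc (Pi.single j 1 + Pi.single i 1) (x - x') := by
  rw [fejerKernel_eq, pderivSnd_fejerKernelDeriv, pderivFst_fejerKernelDeriv, zero_add]
  simp

theorem hessSnd_fejerKernel : hessSnd (fejerKernel d hfc) x x' i j =
    fejerKernelDeriv hfc (Pi.single j 1 + Pi.single i 1) (x - x') := by
  rw [hessSnd, fejerKernel_eq, Matrix.of_apply, pderivSnd_fejerKernelDeriv,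
    pderivSnd_fejerKernelDeriv, zero_add]
  simp

theorem gradFstHessSnd_fejerKernel : gradFstHessSnd (fejerKernel d hfc) x x' l i j =
    fejerKernelDeriv hfc (Pi.single j 1 + Pi.single i 1 + Pi.single l 1) (x - x') := by
  rw [gradFstHessSnd, fejerKernel_eq, Matrix.of_apply, pderivSnd_fejerKernelDeriv,
    pderivSnd_fejerKernelDeriv, pderivFst_fejerKernelDeriv, zero_add]
  simp

end Formulas

theorem fejerKernel_symm {d fc : ℕ} (hfc : Even fc) (x x' : Torus d) :
    fejerKernel d hfc x x' = fejerKernel d hfc x' x := by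
  unfold fejerKernel
  refine Finset.prod_congr rfl fun k _ => ?_
  rw [← neg_sub (x' k) (x k)]
  obtain ⟨s, hs⟩ := QuotientAddGroup.mk_surjective (x' k - x k)
  replace hs : (s : UnitAddCircle) = x' k - x k := hs
  obtain ⟨m, rfl⟩ := hfc
  rw [← hs, ← AddCircle.coe_neg]
  exact fejer_neg m s

theorem contDiff_fejerKernel {d fc : ℕ} (hfc : Even fc) :
    ContDiff ℝ 3 (fun p : (Fin d → ℝ) × (Fin d → ℝ) =>
      fejerKernel d hfc (toTorus p.1) (toTorus p.2)) := by
  have h : (fun p : (Fin d → ℝ) × (Fin d → ℝ) => fejerKernel d hfc (toTorus p.1) (toTorus p.2)) =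
      fun p => ∏ k, fejer fc (p.1 k - p.2 k) := rfl
  rw [h]
  obtain ⟨m, rfl⟩ := hfc
  refine contDiff_prod fun k _ => ContDiff.comp (g := fejer (m + m)) (contDiff_fejer m 3) ?_
  fun_prop

/-- Every point of the torus has a representative in `[-1/2, 1/2]^d`, and the coordinates of that
representative have the norms of the coordinates of the point. -/
theorem exists_torus_rep {d : ℕ} (y : Torus d) :
    ∃ s : Fin d → ℝ, (∀ k, (s k : UnitAddCircle) = y k) ∧ (∀ k, |s k| = ‖y k‖) ∧
      ∀ k, |s k| ≤ 1 / 2 := by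
  have h : ∀ k, ∃ s : ℝ, (s : UnitAddCircle) = y k ∧ |s| = ‖y k‖ ∧ |s| ≤ 1 / 2 := by
    intro k
    obtain ⟨a, ha⟩ := QuotientAddGroup.mk_surjective (y k)
    replace ha : (a : UnitAddCircle) = y k := ha
    refine ⟨a - round a, ?_, ?_, abs_sub_round a⟩
    · rw [AddCircle.coe_sub, ← ha, sub_eq_self]
      have := AddCircle.coe_eq_zero_iff (1 : ℝ) (x := (round a : ℝ))
      exact this.2 ⟨round a, by simp⟩
    · rw [← ha, UnitAddCircle.norm_eq]
  choose s h1 h2 h3 using h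
  exact ⟨s, h1, h2, h3⟩

/-! ### Bounds for the derivatives of the Fejér kernel -/

theorem sum_add_single {d : ℕ} (ν : Fin d → ℕ) (i : Fin d) :
    ∑ k, (ν + Pi.single i 1 : Fin d → ℕ) k = ∑ k, ν k + 1 := by
  simp [Finset.sum_add_distrib]

theorem abs_fejerCircleDeriv_le {m : ℕ} (hfc : Even (m + m)) {n : ℕ} (hn : n ≤ 3)
    (z : UnitAddCircle) : |fejerCircleDeriv hfc n z| ≤ (4 * Real.pi * m) ^ n := by
  obtain ⟨s, rfl⟩ := QuotientAddGroup.mk_surjective z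
  exact abs_iteratedDeriv_fejer_le m hn s

theorem abs_fejerKernelDeriv_le {d m : ℕ} (hfc : Even (m + m)) {ν : Fin d → ℕ}
    (hν : ∑ k, ν k ≤ 3) (y : Torus d) :
    |fejerKernelDeriv hfc ν y| ≤ (4 * Real.pi * m) ^ ∑ k, ν k := by
  unfold fejerKernelDeriv
  rw [Finset.abs_prod, ← Finset.prod_pow_eq_pow_sum]
  refine Finset.prod_le_prod (fun _ _ => abs_nonneg _) fun k hk => abs_fejerCircleDeriv_le hfc ?_ _
  exact (Finset.single_le_sum (fun _ _ => Nat.zero_le _) hk).trans hν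

/-- Decay of the kernel: one coordinate of `y` is at least `ρ`, and its factor is small. -/
theorem abs_fejerKernelDeriv_le_decay {d m : ℕ} (hm : 64 ≤ m) (hfc : Even (m + m)) {ν : Fin d → ℕ}
    (hν : ∑ k, ν k ≤ 3) {ρ : ℝ} (hρ0 : 0 < ρ) (hρ : ρ ≤ 5 / 128)
    (hρm : 3.9 ≤ 0.997 * Real.pi * m * ρ) {y : Torus d} (hy : ρ ≤ ‖y‖) :
    |fejerKernelDeriv hfc ν y| ≤ decayConst (∑ k, ν k) * (0.997 * Real.pi * m * ρ)⁻¹ ^ 4 *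
      (4 * Real.pi * m) ^ ∑ k, ν k := by
  obtain ⟨s, hs, hsn, hsh⟩ := exists_torus_rep y
  obtain ⟨i, hi⟩ : ∃ i, ρ ≤ ‖y i‖ := by
    by_contra! h
    exact absurd hy (not_le.2 ((pi_norm_lt_iff hρ0).2 h))
  have hle : ∀ k, ν k ≤ ∑ k, ν k := fun k =>
    Finset.single_le_sum (fun _ _ => Nat.zero_le _) (Finset.mem_univ k)
  have hS := le_mul_abs_sin (m := m) hρ0.le hρ (by rw [hsn]; exact hi) (hsh i)
  have hS0 : 0 < 0.997 * Real.pi * m * ρ := lt_of_lt_of_le (by norm_num) hρm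
  have h1 := abs_iteratedDeriv_fejer_le_decay hm ((hle i).trans hν) (hρm.trans hS)
  rw [← fejerCircleDeriv_coe hfc, hs] at h1
  unfold fejerKernelDeriv
  rw [Finset.abs_prod, ← Finset.prod_pow_eq_pow_sum,
    ← Finset.mul_prod_erase _ _ (Finset.mem_univ i),
    ← Finset.mul_prod_erase _ (fun k => (4 * Real.pi * m) ^ ν k) (Finset.mem_univ i), ← mul_assoc]
  have hc0 : ∀ n, 0 ≤ decayConst n := fun n => zero_le_one.trans (one_le_decayConst n)
  refine mul_le_mul (h1.trans ?_) (Finset.prod_le_prod (fun _ _ => abs_nonneg _) fun k _ =>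
    abs_fejerCircleDeriv_le hfc ((hle k).trans hν) _)
    (Finset.prod_nonneg fun _ _ => abs_nonneg _)
    (mul_nonneg (mul_nonneg (hc0 _) (by positivity)) (by positivity))
  rw [mul_right_comm]
  have := hc0 (∑ k, ν k)
  gcongr
  exact decayConst_mono (hle i)

/-- The kernel is bounded away from `1` outside a neighbourhood of the diagonal. -/
theorem abs_fejerKernelDeriv_zero_le {d m : ℕ} (hm : 64 ≤ m) (hfc : Even (m + m)) {r ρ : ℝ}
    (hr0 : 0 ≤ r) (hr : r ≤ 1) (hρ0 : 0 < ρ) (hρ : 0.0025 * r ≤ (m * ρ) ^ 2) {y : Torus d}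
    (hy : ρ ≤ ‖y‖) : |fejerKernelDeriv hfc 0 y| ≤ 1 - 0.0162 * r := by
  obtain ⟨s, hs, hsn, hsh⟩ := exists_torus_rep y
  obtain ⟨i, hi⟩ : ∃ i, ρ ≤ ‖y i‖ := by
    by_contra! h
    exact absurd hy (not_le.2 ((pi_norm_lt_iff hρ0).2 h))
  unfold fejerKernelDeriv
  rw [Finset.abs_prod, ← Finset.mul_prod_erase _ _ (Finset.mem_univ i)]
  have h1 : |fejerCircleDeriv hfc 0 (y i)| ≤ 1 - 0.0162 * r := by
    rw [← hs, fejerCircleDeriv_coe, iteratedDeriv_zero, abs_of_nonneg (by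
      rw [fejer_eq_dirichletDeriv_pow]; exact Even.pow_nonneg (by decide) _)]
    refine fejer_le_one_sub hm hr0 hr (hρ.trans ?_) (hsh i)
    rw [mul_pow, mul_pow, ← sq_abs (s i)]
    gcongr
    rw [hsn]; exact hi
  refine (mul_le_mul h1 (Finset.prod_le_one (fun _ _ => abs_nonneg _) fun k _ => ?_)
    (Finset.prod_nonneg fun _ _ => abs_nonneg _) ((abs_nonneg _).trans h1)).trans_eq (mul_one _)
  simpa using abs_fejerCircleDeriv_le hfc (Nat.zero_le 3) (y k)

/-! ### Norms of vectors, matrices and tensors with bounded entries -/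

theorem sum_mul_sq_le_of_abs_le {d : ℕ} {f : Fin d → ℝ} {B : ℝ}
    (h : ∀ j, |f j| ≤ B) (x : Fin d → ℝ) :
    (∑ j, f j * x j) ^ 2 ≤ d * B ^ 2 * ∑ j, x j ^ 2 := by
  refine (Finset.sum_mul_sq_le_sq_mul_sq _ _ _).trans ?_
  refine mul_le_mul_of_nonneg_right ?_ (Finset.sum_nonneg fun _ _ => sq_nonneg _)
  calc ∑ j, f j ^ 2 ≤ ∑ _j : Fin d, B ^ 2 := Finset.sum_le_sum fun j _ => by
        rw [← sq_abs]; have := h j; gcongr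
    _ = _ := by simp

theorem norm_toLp_le_of_abs_le {d : ℕ} {f : Fin d → ℝ} {B : ℝ} (hB : 0 ≤ B)
    (h : ∀ j, |f j| ≤ B) : ‖(WithLp.toLp 2 f : EuclideanSpace ℝ (Fin d))‖ ≤ √d * B := by
  rw [EuclideanSpace.norm_eq, ← Real.sqrt_sq hB, ← Real.sqrt_mul (Nat.cast_nonneg d)]
  refine Real.sqrt_le_sqrt ?_
  calc _ ≤ ∑ _j : Fin d, B ^ 2 := Finset.sum_le_sum fun j _ => by
        rw [Real.norm_eq_abs]; have := h j; gcongr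
    _ = _ := by simp

theorem specNorm_le_of_abs_le {d : ℕ} {A : Matrix (Fin d) (Fin d) ℝ} {B : ℝ} (hB : 0 ≤ B)
    (h : ∀ i j, |A i j| ≤ B) : specNorm A ≤ d * B := by
  unfold specNorm
  refine ContinuousLinearMap.opNorm_le_bound _ (by positivity) fun x => ?_
  have hx : ‖x‖ ^ 2 = ∑ j, x j ^ 2 := EuclideanSpace.real_norm_sq_eq x
  refine le_of_sq_le_sq ?_ (by positivity)
  rw [EuclideanSpace.real_norm_sq_eq, mul_pow, hx]
  calc _ ≤ ∑ _i : Fin d, d * B ^ 2 * ∑ j, x j ^ 2 := Finset.sum_le_sum fun i _ =>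
        sum_mul_sq_le_of_abs_le (h i) x
    _ = _ := by rw [Finset.sum_const, Finset.card_fin, nsmul_eq_mul]; ring

theorem tensorNormLE_of_abs_le {d : ℕ} {T : Fin d → Matrix (Fin d) (Fin d) ℝ} {B : ℝ} (hB : 0 ≤ B)
    (h : ∀ l i j, |T l i j| ≤ B) : TensorNormLE T (d * √d * B) := by
  intro u
  have hu : ‖u‖ ^ 2 = ∑ j, u j ^ 2 := EuclideanSpace.real_norm_sq_eq u
  have key : ∀ i j, |(∑ l, u l • T l) i j| ≤ √d * B * ‖u‖ := by
    intro i j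
    refine abs_le_of_sq_le_sq ?_ (by positivity)
    have hT : (∑ l, u l • T l) i j = ∑ l, T l i j * u l := by
      rw [Matrix.sum_apply]
      exact Finset.sum_congr rfl fun l _ => mul_comm _ _
    rw [mul_pow, mul_pow, Real.sq_sqrt (Nat.cast_nonneg d), hu, hT]
    exact sum_mul_sq_le_of_abs_le (fun l => h l i j) u
  refine (specNorm_le_of_abs_le (by positivity) key).trans_eq ?_
  ring

/-- Every eigenvalue is a value of the Rayleigh quotient. -/
theorem exists_quadForm_eq_of_hasEigenvalue {d : ℕ} {A : Matrix (Fin d) (Fin d) ℝ} {μ : ℝ}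
    (h : Module.End.HasEigenvalue (Matrix.toLin' A) μ) :
    ∃ v : Fin d → ℝ, 0 < ∑ i, v i ^ 2 ∧ ∑ i, ∑ j, A i j * (v i * v j) = μ * ∑ i, v i ^ 2 := by
  obtain ⟨v, hv⟩ := h.exists_hasEigenvector
  refine ⟨v, ?_, ?_⟩
  · obtain ⟨i, hi⟩ := Function.ne_iff.1 hv.2
    exact Finset.sum_pos' (fun _ _ => sq_nonneg _) ⟨i, Finset.mem_univ i, sq_pos_of_ne_zero hi⟩
  · have h1 := hv.apply_eq_smul
    rw [Matrix.toLin'_apply] at h1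
    rw [Finset.mul_sum]
    refine Finset.sum_congr rfl fun i _ => ?_
    have h2 : ∑ j, A i j * v j = μ * v i := congrFun h1 i
    calc _ = v i * ∑ j, A i j * v j := by
          rw [Finset.mul_sum]; exact Finset.sum_congr rfl fun j _ => by ring
      _ = _ := by rw [h2]; ring

theorem sq_sum_abs_le {d : ℕ} (v : Fin d → ℝ) : (∑ i, |v i|) ^ 2 ≤ d * ∑ i, v i ^ 2 := by
  have := sq_sum_le_card_mul_sum_sq (s := Finset.univ) (f := fun i => |v i|)
  simpa using this

theorem neg_le_of_hasEigenvalue {d : ℕ} {A : Matrix (Fin d) (Fin d) ℝ} {μ B : ℝ} (hB : 0 ≤ B)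
    (hA : ∀ i j, |A i j| ≤ B) (h : Module.End.HasEigenvalue (Matrix.toLin' A) μ) :
    -(d * B) ≤ μ := by
  obtain ⟨v, hv, hq⟩ := exists_quadForm_eq_of_hasEigenvalue h
  refine le_of_mul_le_mul_right ?_ hv
  rw [← hq]
  calc _ = -(B * (d * ∑ i, v i ^ 2)) := by ring
    _ ≤ -(B * (∑ i, |v i|) ^ 2) := by
        have := sq_sum_abs_le v; gcongr
    _ = ∑ i, ∑ j, -(B * (|v i| * |v j|)) := by
        rw [sq, Finset.sum_mul_sum]; simp only [Finset.mul_sum, Finset.sum_neg_distrib]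
    _ ≤ _ := by
        refine Finset.sum_le_sum fun i _ => Finset.sum_le_sum fun j _ => ?_
        refine neg_le_of_abs_le ?_
        rw [abs_mul, abs_mul]
        have := hA i j
        gcongr

/-! ### The Hessian near the diagonal -/

/-- Near the diagonal, the Hessian is the sum of a diagonal part close to `κ''(0)` and of an
off-diagonal part dominated by the rank-one matrix of the products `|κ'(s i)| |κ'(s j)|`. -/
theorem quadForm_fejerKernelDeriv_le {d m : ℕ} (hd : 0 < d) (hm : 64 ≤ m) (hfc : Even (m + m))
    {y : Torus d} (hy : (m * ‖y‖) ^ 2 ≤ 0.0025 / d) (v : Fin d → ℝ) :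
    ∑ i, ∑ j, fejerKernelDeriv hfc (Pi.single j 1 + Pi.single i 1) y * (v i * v j) ≤
      -(4 * m ^ 2) * ∑ i, v i ^ 2 := by
  have hd' : (1 : ℝ) ≤ d := by exact_mod_cast hd
  have hd0 : (0 : ℝ) < d := by linarith
  obtain ⟨s, hs, hsn, -⟩ := exists_torus_rep y
  have hsy : ∀ k, (m * s k) ^ 2 ≤ 0.0025 / d := by
    intro k
    refine le_trans ?_ hy
    rw [mul_pow, mul_pow, ← sq_abs (s k), hsn]
    have := norm_le_pi_norm y k
    gcongr
  have hsy' : ∀ k, (m * s k) ^ 2 ≤ 0.0025 := fun k =>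
    (hsy k).trans (div_le_self (by norm_num) hd')
  have hK : ∀ ν : Fin d → ℕ, fejerKernelDeriv hfc ν y =
      ∏ k, iteratedDeriv (ν k) (fejer (m + m)) (s k) := by
    intro ν
    unfold fejerKernelDeriv
    simp only [← hs, fejerCircleDeriv_coe]
  have hκ1 : ∀ k, |fejer (m + m) (s k)| ≤ 1 := fun k => by
    simpa using abs_iteratedDeriv_fejer_le m (Nat.zero_le 3) (s k)
  have hdiag : ∀ i, fejerKernelDeriv hfc (Pi.single i 1 + Pi.single i 1) y ≤ -(11 * m ^ 2) := by
    intro i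
    rw [hK, ← Finset.mul_prod_erase _ _ (Finset.mem_univ i)]
    have h1 : ∏ k ∈ Finset.univ.erase i, iteratedDeriv
        ((Pi.single i 1 + Pi.single i 1 : Fin d → ℕ) k) (fejer (m + m)) (s k) =
        ∏ k ∈ Finset.univ.erase i, fejer (m + m) (s k) := by
      refine Finset.prod_congr rfl fun k hk => ?_
      simp [Finset.ne_of_mem_erase hk]
    have h2 : 0.98 ≤ ∏ k ∈ Finset.univ.erase i, fejer (m + m) (s k) := by
      have ha1 : (0.017 : ℝ) / d ≤ 0.017 := div_le_self (by norm_num) hd'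
      have ha0 : (0 : ℝ) ≤ 1 - 0.017 / d := by norm_num at ha1 ⊢; linarith
      calc (0.98 : ℝ) ≤ 1 + d * (-(0.017 / d)) := by
            rw [mul_neg, mul_div_cancel₀ _ hd0.ne']; norm_num
        _ ≤ (1 + -(0.017 / d)) ^ d := one_add_mul_le_pow (by norm_num at ha1 ⊢; linarith) d
        _ ≤ (1 - 0.017 / d) ^ (Finset.univ.erase i).card := by
            rw [← sub_eq_add_neg]
            refine pow_le_pow_of_le_one ha0 (by simp; positivity) ?_
            exact (Finset.card_le_univ _).trans_eq (Fintype.card_fin d)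
        _ = ∏ k ∈ Finset.univ.erase i, (1 - 0.017 / d : ℝ) := by rw [Finset.prod_const]
        _ ≤ _ := by
            refine Finset.prod_le_prod (fun _ _ => ha0) fun k _ => ?_
            refine le_trans ?_ (one_sub_le_fejer hm (hsy' k))
            have := hsy k
            rw [show (0.017 : ℝ) / d = 6.8 * (0.0025 / d) by ring]
            gcongr
    have h3 := iteratedDeriv_two_fejer_le hm (hsy' i)
    rw [h1, Pi.add_apply, Pi.single_eq_same, one_add_one_eq_two]
    have h4 := mul_le_mul (le_neg.1 (h3.trans_eq (neg_mul _ _))) h2 (by norm_num) (by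
      have : (0 : ℝ) ≤ 12 * m ^ 2 := by positivity
      linarith [neg_mul (12 : ℝ) (m ^ 2)])
    norm_num at h4 ⊢
    nlinarith [sq_nonneg (m : ℝ)]
  have hoff : ∀ i j, i ≠ j → |fejerKernelDeriv hfc (Pi.single j 1 + Pi.single i 1) y| ≤
      |iteratedDeriv 1 (fejer (m + m)) (s i)| * |iteratedDeriv 1 (fejer (m + m)) (s j)| := by
    intro i j hij
    rw [hK, ← Finset.mul_prod_erase _ _ (Finset.mem_univ i),
      ← Finset.mul_prod_erase _ _ (Finset.mem_erase.2 ⟨hij.symm, Finset.mem_univ j⟩), ← mul_assoc,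
      abs_mul, abs_mul]
    have h1 : ∀ k, k ≠ i → k ≠ j → (Pi.single j 1 + Pi.single i 1 : Fin d → ℕ) k = 0 := by
      intro k h1 h2; simp [h1, h2]
    have e1 : (Pi.single j 1 + Pi.single i 1 : Fin d → ℕ) i = 1 := by simp [hij]
    have e2 : (Pi.single j 1 + Pi.single i 1 : Fin d → ℕ) j = 1 := by simp [hij.symm]
    rw [e1, e2]
    refine mul_le_of_le_one_right (by positivity) ?_
    rw [Finset.abs_prod]
    refine Finset.prod_le_one (fun _ _ => abs_nonneg _) fun k hk => ?_
    rw [h1 k (Finset.ne_of_mem_erase (Finset.mem_of_mem_erase hk)) (Finset.ne_of_mem_erase hk),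
      iteratedDeriv_zero]
    exact hκ1 k
  have hgrad : ∀ i, |iteratedDeriv 1 (fejer (m + m)) (s i)| ≤ 0.68 * m / √d := by
    intro i
    refine (abs_iteratedDeriv_one_fejer_le hm (s i)).trans ?_
    have : |m * s i| ≤ 0.05 / √d := by
      refine abs_le_of_sq_le_sq ((hsy i).trans_eq ?_) (by positivity)
      rw [div_pow, Real.sq_sqrt hd0.le]; norm_num
    calc _ ≤ 13.6 * m * (0.05 / √d) := by gcongr
      _ = _ := by ring
  have hterm : ∀ i j, fejerKernelDeriv hfc (Pi.single j 1 + Pi.single i 1) y * (v i * v j) ≤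
      (if i = j then -(11 * m ^ 2) * v i ^ 2 else 0) +
        (0.68 * m / √d) ^ 2 * (|v i| * |v j|) := by
    intro i j
    split_ifs with h
    · subst h
      have := mul_le_mul_of_nonneg_right (hdiag i) (mul_self_nonneg (v i))
      have h2 : 0 ≤ (0.68 * m / √d) ^ 2 * (|v i| * |v i|) := by positivity
      linarith [sq (v i)]
    · rw [zero_add]
      refine (le_abs_self _).trans ?_
      rw [abs_mul, abs_mul, sq]
      have h1 := hgrad i
      have h2 := hgrad j
      have h3 := hoff i j h
      refine mul_le_mul_of_nonneg_right (h3.trans ?_) (by positivity)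
      gcongr
  calc _ ≤ ∑ i, ∑ j, ((if i = j then -(11 * m ^ 2) * v i ^ 2 else 0) +
        (0.68 * m / √d) ^ 2 * (|v i| * |v j|)) :=
        Finset.sum_le_sum fun i _ => Finset.sum_le_sum fun j _ => hterm i j
    _ = -(11 * m ^ 2) * ∑ i, v i ^ 2 + (0.68 * m / √d) ^ 2 * (∑ i, |v i|) ^ 2 := by
        rw [sq (∑ i, |v i|), Finset.sum_mul_sum]
        simp only [Finset.sum_add_distrib, Finset.sum_ite_eq, Finset.mem_univ, if_true,
          Finset.mul_sum]
    _ ≤ -(11 * m ^ 2) * ∑ i, v i ^ 2 + (0.68 * m / √d) ^ 2 * (d * ∑ i, v i ^ 2) := by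
        have := sq_sum_abs_le v
        gcongr
    _ = (-11 + 0.68 ^ 2) * (m ^ 2 * ∑ i, v i ^ 2) := by
        rw [div_pow, Real.sq_sqrt hd0.le]; field_simp
    _ ≤ _ := by
        have : 0 ≤ (m : ℝ) ^ 2 * ∑ i, v i ^ 2 :=
          mul_nonneg (sq_nonneg _) (Finset.sum_nonneg fun _ _ => sq_nonneg _)
        norm_num; linarith

/-! ### The constants and the conclusion -/

/-- The constants of the Fejér kernel in dimension `d`, in terms of its largest frequency
`a = 2π f_c`.  The numbers `0.0043 / d²` and `0.00027 / d²` bound the decay at distance `Δ / 2` and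
`Δ`; the factors `1.3`, `1.8`, `2.6` are those of `decayConst`.  The value `√v = 0.288 a` lies just
below `√(-κ''(0))`, so that `u` is a rational number divided by `d²`. -/
def fejerConstants (d : ℕ) (a : ℝ) : KernelConstants where
  a₁ := 0
  a₂ := 0
  v := (0.288 * a) ^ 2
  b₂ := d * a ^ 2
  b₃ := d * √d * a ^ 3
  lam₁ := a ^ 2 / 40
  c₀ := 1 - 0.0162 / d
  c₁ := √d * a
  e₀ := 0.0043 / d ^ 2
  e₁ := √d * (1.3 * (0.0043 / d ^ 2) * a)
  e₂ := d * (1.8 * (0.0043 / d ^ 2) * a ^ 2)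
  e₃ := d * √d * (2.6 * (0.0043 / d ^ 2) * a ^ 3)
  h₀ := 0.00027 / d ^ 2
  h₁ := 1.3 * (0.00027 / d ^ 2) * a
  h₂ := d * (1.8 * (0.00027 / d ^ 2) * a ^ 2)

theorem fejerKernelDeriv_zero_eq {d fc : ℕ} (hfc : Even fc) (ν : Fin d → ℕ) :
    fejerKernelDeriv hfc ν 0 = ∏ k, iteratedDeriv (ν k) (fejer fc) 0 := rfl

theorem dirichletDeriv_zero_zero (m : ℕ) : dirichletDeriv m 0 0 = 1 := by
  have : (m : ℝ) + 1 ≠ 0 := by positivity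
  simp [dirichletDeriv, this]

theorem dirichletDeriv_one_zero (m : ℕ) : dirichletDeriv m 1 0 = 0 := by
  simp [dirichletDeriv]

theorem dirichletDeriv_two_zero (m : ℕ) : dirichletDeriv m 2 0 = -dirichletVar m := by
  have h : (m : ℝ) + 1 ≠ 0 := by positivity
  have : (2 : ℝ) * (Real.pi / 2) = Real.pi := by ring
  simp only [dirichletDeriv, mul_zero, zero_add, Nat.cast_ofNat, this, Real.cos_pi, mul_neg,
    mul_one, Finset.sum_neg_distrib, sum_dirichletFreq_sq]
  field_simp

theorem fejer_zero (m : ℕ) : fejer (m + m) 0 = 1 := by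
  rw [fejer_eq_dirichletDeriv_pow, dirichletDeriv_zero_zero, one_pow]

theorem iteratedDeriv_one_fejer_zero (m : ℕ) : iteratedDeriv 1 (fejer (m + m)) 0 = 0 := by
  rw [iteratedDeriv_one_fejer]; simp [dirichletDeriv_one_zero]

theorem iteratedDeriv_two_fejer_zero (m : ℕ) :
    iteratedDeriv 2 (fejer (m + m)) 0 = -(4 * dirichletVar m) := by
  rw [iteratedDeriv_two_fejer]
  simp [dirichletDeriv_zero_zero, dirichletDeriv_one_zero, dirichletDeriv_two_zero]

/-- Decay at distance `ρ` with `m ρ` at least a multiple `c` of `(d² smax)^(1/4)`. -/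
theorem abs_fejerKernelDeriv_le_div {d m smax : ℕ} (hm : 64 ≤ m) (hfc : Even (m + m)) {g ρ c q : ℝ}
    (hg1 : 1 ≤ g) (hg : g ^ 4 = d ^ 2 * smax) (hρ0 : 0 < ρ) (hρ : ρ ≤ 5 / 128) (hc : 1.25 ≤ c)
    (hcρ : c * g ≤ m * ρ) (hcq : (3.132 * c)⁻¹ ^ 4 ≤ q) {n : ℕ} (hn : n ≤ 3) {ν : Fin d → ℕ}
    (hν : ∑ k, ν k = n) {y : Torus d} (hy : ρ ≤ ‖y‖) :
    |fejerKernelDeriv hfc ν y| ≤ decayConst n * (q / d ^ 2) * (4 * Real.pi * m) ^ n / smax := by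
  have h1 : 3.132 * c * g ≤ 0.997 * Real.pi * m * ρ := by
    have h2 : 3.132 ≤ 0.997 * Real.pi := by
      have := Real.pi_gt_d4; norm_num at this ⊢; linarith
    calc _ = 3.132 * (c * g) := by ring
      _ ≤ 0.997 * Real.pi * (m * ρ) := by gcongr
      _ = _ := by ring
  have h3 : 3.9 ≤ 3.132 * c * g := by norm_num at hc ⊢; nlinarith
  have h4 := abs_fejerKernelDeriv_le_decay hm hfc (hν.trans_le hn) hρ0 hρ (h3.trans h1) hy
  rw [hν] at h4
  have hc0 := zero_le_one.trans (one_le_decayConst n)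
  refine h4.trans ?_
  have h5 : (0.997 * Real.pi * m * ρ)⁻¹ ^ 4 ≤ q / d ^ 2 / smax := by
    calc _ ≤ (3.132 * c * g)⁻¹ ^ 4 := by gcongr
      _ = (3.132 * c)⁻¹ ^ 4 / (d ^ 2 * smax) := by
          rw [mul_inv, mul_pow, inv_pow g, hg, div_eq_mul_inv]
      _ ≤ _ := by rw [div_div]; gcongr
  calc _ ≤ decayConst n * (q / d ^ 2 / smax) * (4 * Real.pi * m) ^ n := by gcongr
    _ = _ := by ring

theorem kernelBounds_fejerKernel {d m smax : ℕ} (hd : 0 < d) (hm : 64 ≤ m) (hfc : Even (m + m))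
    {g εnear Δ : ℝ} (hg1 : 1 ≤ g) (hg : g ^ 4 = d ^ 2 * smax) (hε0 : 0 < εnear)
    (hε : (m * εnear) ^ 2 = 0.0025 / d) (hΔ : m * Δ = 2.5 * g) (hΔle : Δ ≤ 5 / 128) :
    KernelBounds (fejerKernel d hfc) (fun t => ‖t‖) smax εnear Δ
      (fejerConstants d (4 * Real.pi * m)) := by
  have hm' : (64 : ℝ) ≤ m := by exact_mod_cast hm
  have hm0 : (0 : ℝ) < m := by linarith
  have hd' : (1 : ℝ) ≤ d := by exact_mod_cast hd
  have hd0 : (0 : ℝ) < d := by linarith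
  have hΔ0 : 0 < Δ := pos_of_mul_pos_right (by rw [hΔ]; positivity) hm0.le
  have hpi := Real.pi_pos
  set a := 4 * Real.pi * (m : ℝ) with ha
  have ha0 : 0 < a := by positivity
  have hone : ∀ i : Fin d, ∑ k, (Pi.single i 1 : Fin d → ℕ) k = 1 := fun i => by simp
  have htwo : ∀ i j : Fin d, ∑ k, (Pi.single j 1 + Pi.single i 1 : Fin d → ℕ) k = 2 :=
    fun i j => by rw [sum_add_single, hone]
  have hthree : ∀ i j l : Fin d,
      ∑ k, (Pi.single j 1 + Pi.single i 1 + Pi.single l 1 : Fin d → ℕ) k = 3 :=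
    fun i j l => by rw [sum_add_single, htwo]
  have hglob : ∀ {n : ℕ} {ν : Fin d → ℕ} (y : Torus d), n ≤ 3 → ∑ k, ν k = n →
      |fejerKernelDeriv hfc ν y| ≤ a ^ n := by
    intro n ν y hn hν
    have := abs_fejerKernelDeriv_le hfc (hν.trans_le hn) y
    rwa [hν] at this
  have hhalf : ∀ {n : ℕ} {ν : Fin d → ℕ} {y : Torus d}, Δ / 2 ≤ ‖y‖ → n ≤ 3 → ∑ k, ν k = n →
      |fejerKernelDeriv hfc ν y| ≤ decayConst n * (0.0043 / d ^ 2) * a ^ n / smax := by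
    intro n ν y hy hn hν
    exact abs_fejerKernelDeriv_le_div (c := 1.25) hm hfc hg1 hg (by positivity) (by linarith)
      le_rfl (by norm_num at hΔ ⊢; linarith) (by norm_num) hn hν hy
  have hsep : ∀ {n : ℕ} {ν : Fin d → ℕ} {y : Torus d}, Δ ≤ ‖y‖ → n ≤ 3 → ∑ k, ν k = n →
      |fejerKernelDeriv hfc ν y| ≤ decayConst n * (0.00027 / d ^ 2) * a ^ n / smax := by
    intro n ν y hy hn hν
    exact abs_fejerKernelDeriv_le_div (c := 2.5) hm hfc hg1 hg hΔ0 hΔle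
      (by norm_num) hΔ.ge (by norm_num) hn hν hy
  constructor
  · exact contDiff_fejerKernel hfc
  · exact fejerKernel_symm hfc
  · intro x
    rw [fejerKernel_apply, sub_self, fejerKernelDeriv_zero_eq]
    simp [fejer_zero]
  · intro x i
    rw [pderivFst_fejerKernel, sub_self, fejerKernelDeriv_zero_eq,
      Finset.prod_eq_zero (Finset.mem_univ i) (by simp [iteratedDeriv_one_fejer_zero])]
    simp [fejerConstants]
  · intro x i j hij
    rw [pderivFst_pderivSnd_fejerKernel, sub_self, fejerKernelDeriv_zero_eq,
      Finset.prod_eq_zero (Finset.mem_univ i) (by simp [hij, iteratedDeriv_one_fejer_zero])]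
    simp [fejerConstants]
  · intro x i
    rw [pderivFst_pderivSnd_fejerKernel, sub_self, fejerKernelDeriv_zero_eq,
      Finset.prod_eq_single_of_mem i (Finset.mem_univ i) (fun k _ hk => by simp [hk, fejer_zero])]
    simp only [Pi.add_apply, Pi.single_eq_same, one_add_one_eq_two, iteratedDeriv_two_fejer_zero,
      neg_neg, fejerConstants]
    have h1 := dirichletVar_lower m
    have h2 := mul_le_mul_of_nonneg_right pi_sq_bounds.2 (sq_nonneg (m : ℝ))
    rw [ha]
    norm_num at h1 h2 ⊢
    nlinarith
  · simp only [fejerConstants]; positivity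
  · intro x x' hx μ hμ
    constructor
    · simp only [fejerConstants]
      refine neg_le_of_hasEigenvalue (by positivity) (fun i j => ?_) hμ
      rw [hessSnd_fejerKernel]
      exact hglob _ (by norm_num) (htwo i j)
    · obtain ⟨v, hv, hq⟩ := exists_quadForm_eq_of_hasEigenvalue hμ
      simp only [hessSnd_fejerKernel] at hq
      have hy : (m * ‖x - x'‖) ^ 2 ≤ 0.0025 / d := by
        rw [← hε]; gcongr
      have h1 := quadForm_fejerKernelDeriv_le hd hm hfc hy v
      rw [hq] at h1
      refine (le_of_mul_le_mul_right h1 hv).trans ?_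
      simp only [fejerConstants, ha]
      have h2 := mul_le_mul_of_nonneg_right pi_sq_bounds.2 (sq_nonneg (m : ℝ))
      norm_num at h2 ⊢
      nlinarith
  · intro x x' _
    refine tensorNormLE_of_abs_le (by positivity) fun l i j => ?_
    rw [gradFstHessSnd_fejerKernel]
    exact hglob _ le_rfl (hthree i j l)
  · intro x x' hx
    rw [fejerKernel_apply]
    have := abs_fejerKernelDeriv_zero_le hm hfc (r := 1 / d) (by positivity)
      (div_le_one_of_le₀ hd' hd0.le) hε0 (by rw [hε]; exact (mul_one_div _ _).le) hx
    rwa [mul_one_div] at this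
  · intro x x' _
    refine norm_toLp_le_of_abs_le ha0.le fun i => ?_
    rw [pderivFst_fejerKernel, ← pow_one a]
    exact hglob _ (by norm_num) (hone i)
  · intro x x' hx
    rw [fejerKernel_apply]
    have := hhalf hx (Nat.zero_le 3) (ν := 0) (by simp)
    simpa [decayConst, fejerConstants] using this
  · intro x x' hx
    simp only [fejerConstants]
    rw [mul_div_assoc]
    refine norm_toLp_le_of_abs_le (by positivity) fun i => ?_
    rw [pderivFst_fejerKernel]
    exact (hhalf hx (by norm_num) (hone i)).trans_eq (by rw [pow_one]; rfl)
  · intro x x' hx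
    simp only [fejerConstants]
    rw [mul_div_assoc]
    refine specNorm_le_of_abs_le (by positivity) fun i j => ?_
    rw [hessSnd_fejerKernel]
    exact hhalf hx (by norm_num) (htwo i j)
  · intro x x' hx
    simp only [fejerConstants]
    rw [mul_div_assoc]
    refine tensorNormLE_of_abs_le (by positivity) fun l i j => ?_
    rw [gradFstHessSnd_fejerKernel]
    exact hhalf hx le_rfl (hthree i j l)
  · intro x x' hx
    rw [fejerKernel_apply]
    have := hsep hx (Nat.zero_le 3) (ν := 0) (by simp)
    simpa [decayConst, fejerConstants] using this
  · intro x x' hx i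
    rw [pderivFst_fejerKernel]
    exact (hsep hx (by norm_num) (hone i)).trans_eq (by rw [pow_one]; rfl)
  · intro x x' hx i
    simp only [fejerConstants]
    rw [mul_div_assoc]
    calc _ ≤ ∑ _j : Fin d, 1.8 * (0.00027 / d ^ 2) * a ^ 2 / smax :=
          Finset.sum_le_sum fun j _ => by
            rw [pderivFst_pderivSnd_fejerKernel, abs_neg]
            exact hsep hx (by norm_num) (htwo i j)
      _ = _ := by rw [Finset.sum_const, Finset.card_fin, nsmul_eq_mul]

theorem fejerConstants_u {d : ℕ} {a : ℝ} (ha : 0 < a) :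
    (fejerConstants d a).u = 0.00121875 / d ^ 2 := by
  simp only [KernelConstants.u, fejerConstants]
  rw [Real.sqrt_sq (by positivity)]
  field_simp
  norm_num
  ring

/-- The numerical part: the constants satisfy the inequalities of an acceptable kernel, with
`δ = 0.006` and `δ' = 0.0003 / d`. -/
theorem fejerConstants_bounds {d : ℕ} (hd : 0 < d) {a δ δ' : ℝ} (ha : 0 < a) (hδ : δ = 0.006)
    (hδ' : δ' = 0.0003 / d) {C : KernelConstants} (hC : C = fejerConstants d a) :
    C.v⁻¹ * (d * C.a₂ + C.h₂) ≤ δ ∧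
    C.h₀ + d * C.u ^ 2 / (1 - δ) ≤ δ' ∧
    0.0056 / d ≤ 1 - ((C.c₀ + C.e₀) / (1 - δ')
        + C.u * √d / (√C.v * (1 - δ) * (1 - δ')) * (C.c₁ + C.e₁)) ∧
    a ^ 2 / 100 ≤ (1 - δ' / (1 - δ')) * C.lam₁ - C.e₂ / (1 - δ')
        - C.u * √d / (√C.v * (1 - δ) * (1 - δ')) * (C.b₃ + C.e₃) ∧
    max (δ + C.u) (δ' + d * C.u * (1 - C.u / (1 - δ))) ≤ 1 / 2 := by
  have hd' : (1 : ℝ) ≤ d := by exact_mod_cast hd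
  have hd0 : (0 : ℝ) < d := by linarith
  have hu : C.u = 0.00121875 / d ^ 2 := by rw [hC, fejerConstants_u ha]
  rw [hu, hC]
  simp only [fejerConstants]
  rw [Real.sqrt_sq (by positivity : (0 : ℝ) ≤ 0.288 * a)]
  have hs : √(d : ℝ) * √d = d := Real.mul_self_sqrt hd0.le
  obtain ⟨r, hr⟩ : ∃ r : ℝ, r = 1 / d := ⟨_, rfl⟩
  have hrd : (d : ℝ) * r = 1 := by rw [hr]; field_simp
  have hr0 : 0 < r := by rw [hr]; positivity
  have hr1 : r ≤ 1 := by rw [hr]; exact div_le_one_of_le₀ hd' hd0.le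
  have hdiv : ∀ x : ℝ, x / d = x * r := fun x => by rw [hr]; ring
  have hdiv2 : ∀ x : ℝ, x / (d : ℝ) ^ 2 = x * r ^ 2 := fun x => by rw [hr]; ring
  simp only [hdiv, hdiv2] at hδ' ⊢
  have hr2 : r ^ 2 ≤ r := by nlinarith
  have hδ1 : 0 < 1 - δ' := by rw [hδ']; norm_num; linarith
  have hδ2 : δ' ≤ 0.0003 := by rw [hδ']; norm_num; linarith
  have hδ0 : 0 ≤ δ' := by rw [hδ']; positivity
  have ha2 : 0 < a ^ 2 := by positivity
  refine ⟨?_, ?_, ?_, ?_, ?_⟩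
  · have : ((0.288 * a) ^ 2)⁻¹ * (d * 0 + d * (1.8 * (0.00027 * r ^ 2) * a ^ 2)) =
        (1.8 * 0.00027 / 0.288 ^ 2) * r * (d * r) := by field_simp; ring
    rw [this, hrd, hδ]; norm_num; linarith
  · have : d * (0.00121875 * r ^ 2) ^ 2 / (1 - δ) =
        0.00121875 ^ 2 / (1 - δ) * r ^ 3 * (d * r) := by ring
    have hr3 : r ^ 3 ≤ r := by nlinarith
    rw [this, hrd, hδ, hδ']; norm_num; nlinarith
  · have e : 0.00121875 * r ^ 2 * √d / (0.288 * a * (1 - δ) * (1 - δ')) *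
        (√d * a + √d * (1.3 * (0.0043 * r ^ 2) * a)) =
        (0.00121875 / (0.288 * (1 - δ)) * r * (1 + 1.3 * (0.0043 * r ^ 2))) / (1 - δ') := by
      have : (1 - δ) ≠ 0 := by rw [hδ]; norm_num
      calc _ = 0.00121875 * r ^ 2 * (√d * √d) / (0.288 * (1 - δ) * (1 - δ')) *
            (1 + 1.3 * (0.0043 * r ^ 2)) := by field_simp
        _ = 0.00121875 * r * (d * r) / (0.288 * (1 - δ) * (1 - δ')) *
            (1 + 1.3 * (0.0043 * r ^ 2)) := by rw [hs]; ring
        _ = _ := by rw [hrd]; field_simp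
    rw [e, ← add_div, le_sub_comm, div_le_iff₀ hδ1, hδ', hδ]
    have h1 : r * (1 + 1.3 * (0.0043 * r ^ 2)) ≤ 1.0056 * r := by
      norm_num; nlinarith
    norm_num at h1 ⊢
    nlinarith
  · have e : 0.00121875 * r ^ 2 * √d / (0.288 * a * (1 - δ) * (1 - δ')) *
        (d * √d * a ^ 3 + d * √d * (2.6 * (0.0043 * r ^ 2) * a ^ 3)) =
        (0.00121875 / (0.288 * (1 - δ)) * (1 + 2.6 * (0.0043 * r ^ 2))) * a ^ 2 / (1 - δ') := by
      have : (1 - δ) ≠ 0 := by rw [hδ]; norm_num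
      calc _ = 0.00121875 * r ^ 2 * (√d * √d) * d / (0.288 * (1 - δ) * (1 - δ')) *
            (1 + 2.6 * (0.0043 * r ^ 2)) * a ^ 2 := by field_simp
        _ = 0.00121875 * (d * r) ^ 2 / (0.288 * (1 - δ) * (1 - δ')) *
            (1 + 2.6 * (0.0043 * r ^ 2)) * a ^ 2 := by rw [hs]; ring
        _ = _ := by rw [hrd]; field_simp
    have e2 : d * (1.8 * (0.0043 * r ^ 2) * a ^ 2) = 1.8 * 0.0043 * r * a ^ 2 := by
      linear_combination 1.8 * 0.0043 * r * a ^ 2 * hrd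
    have e3 : (1 - δ' / (1 - δ')) * (a ^ 2 / 40) = ((1 - 2 * δ') / 40 * a ^ 2) / (1 - δ') := by
      field_simp; ring
    rw [e, e2, e3, ← sub_div, ← sub_div, le_div_iff₀ hδ1, ← sub_mul, ← sub_mul]
    rw [div_mul_eq_mul_div, mul_div_assoc, mul_comm]
    refine mul_le_mul_of_nonneg_right ?_ ha2.le
    rw [hδ]
    norm_num at hδ2 ⊢
    nlinarith
  · have e : d * (0.00121875 * r ^ 2) = 0.00121875 * r := by
      linear_combination 0.00121875 * r * hrd
    rw [e, hδ]
    refine max_le ?_ ?_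
    · norm_num; linarith
    · have : (0.00121875 * r) * (1 - 0.00121875 * r ^ 2 / (1 - 0.006)) ≤ 0.00121875 * r * 1 := by
        refine mul_le_mul_of_nonneg_left ?_ (by positivity)
        rw [sub_le_self_iff]
        norm_num; positivity
      norm_num at this hδ2 ⊢
      linarith

theorem mainTheorem5 (d fc smax : ℕ) (hd : 0 < d) (hfc : Even fc) (hfc0 : 0 < fc)
    (hsmax : 0 < smax) (εnear Δ : ℝ)
    (hε : εnear = 0.1 / (√(d : ℝ) * fc))
    (hΔ : Δ = 5 * (fc : ℝ)⁻¹ * √(d : ℝ) * (smax : ℝ) ^ ((1 : ℝ) / 4))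
    (hΔle : Δ ≤ 5 / 128) :
    ∃ εη lamη : ℝ,
      AcceptableKernel (fejerKernel d hfc) (fun t => ‖t‖) smax εnear Δ εη lamη ∧
      0.0056 / (d : ℝ) ≤ εη ∧ 0.0318 * (fc : ℝ) ^ 2 ≤ lamη := by
  obtain ⟨m, rfl⟩ := id hfc
  have hm0 : (0 : ℝ) < m := by exact_mod_cast (by omega : 0 < m)
  have hd' : (1 : ℝ) ≤ d := by exact_mod_cast hd
  have hd0 : (0 : ℝ) < d := by linarith
  have hs' : (1 : ℝ) ≤ smax := by exact_mod_cast hsmax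
  push_cast at hε hΔ ⊢
  obtain ⟨g, hgdef⟩ : ∃ g : ℝ, g = √(d : ℝ) * (smax : ℝ) ^ ((1 : ℝ) / 4) := ⟨_, rfl⟩
  have hg1 : 1 ≤ g := by
    rw [hgdef]
    exact one_le_mul_of_one_le_of_one_le (Real.one_le_sqrt.2 hd')
      (Real.one_le_rpow hs' (by norm_num))
  have hg : g ^ 4 = d ^ 2 * smax := by
    rw [hgdef, mul_pow, show (4 : ℕ) = 2 * 2 by norm_num, pow_mul, Real.sq_sqrt hd0.le,
      ← Real.rpow_natCast _ (2 * 2), ← Real.rpow_mul (by positivity)]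
    norm_num
  have hmΔ : m * Δ = 2.5 * g := by
    rw [hΔ, hgdef]; field_simp; norm_num
  have hm : 64 ≤ m := by
    have h1 : 2.5 * g ≤ m * (5 / 128) := by rw [← hmΔ]; gcongr
    have h2 : (64 : ℝ) ≤ m := by norm_num at h1; linarith
    exact_mod_cast h2
  have hε0 : 0 < εnear := by rw [hε]; positivity
  have hmε : (m * εnear) ^ 2 = 0.0025 / d := by
    rw [hε, ← two_mul, mul_div_assoc', div_pow, mul_pow √(d : ℝ), Real.sq_sqrt hd0.le]
    field_simp; norm_num
  have hΔ0 : 0 < Δ := pos_of_mul_pos_right (by rw [hmΔ]; positivity) hm0.le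
  have hpi := Real.pi_pos
  obtain ⟨H1, H2, H3, H4, H5⟩ := fejerConstants_bounds hd (a := 4 * Real.pi * m)
    (by positivity) rfl rfl rfl
  have hδ' : 0.0003 / (d : ℝ) < 1 := by
    rw [div_lt_one hd0]; norm_num; linarith
  have hlam : 0.0318 * ((m : ℝ) + m) ^ 2 ≤ (4 * Real.pi * m) ^ 2 / 100 := by
    have := mul_le_mul_of_nonneg_right pi_sq_bounds.1 (sq_nonneg (m : ℝ))
    norm_num at this ⊢
    nlinarith
  refine ⟨_, _, ⟨hsmax, hε0, hΔ0, lt_of_lt_of_le (by positivity) H3,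
    lt_of_lt_of_le (by positivity) H4, _,
    kernelBounds_fejerKernel hd hm hfc hg1 hg hε0 hmε hmΔ hΔle, _, _, by norm_num, hδ', H1, H2,
    rfl, rfl, H5⟩, H3, hlam.trans H4⟩

end
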